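/- Let $F$ be a field, let $N\ge 2$ be an even integer, let $\mathcal W=\{w_{i,k,j}: 1\le i,k,j\le N\}$ be distinct indeterminates, and let $\mathbb G=F(\mathcal W)$. For integers $i,j$ put $[i,j]=\{k\in\mathbb Z: i\le k\le j\}$. For $|[i,j]|$ even define $g_{i,j}\in\mathbb G[x_1,\dots,x_N]$ by $g_{i,j}=1$ if $[i,j]=\emptyset$, and otherwise $$g_{i,j}=(1+x_ix_j)\,g_{i+1,j-1}+\sum_{k} w_{i,k,j}\,g_{i,k}\,g_{k+1,j},$$ where $k$ ranges over those elements of $[i+1,j-2]$ for which $|[i,k]|$ is even. Let $g=g_{1,N}$ (the Raz–Yehudayoff polynomial). An algebraic branching program (ABP) over $\mathbb G$ is a finite layered directed graph whose edges go from a layer to the next one and are labelled by a variable $x_i$ or a constant of $\mathbb G$, with a start node in the first layer and a terminal node in the last one; it computes the sum, over all paths from the start to the terminal node, of the products of the edge labels. Its size is its number of nodes. An $r$-pass multilinear ABP is an ABP such that (i) for every layer at most one variable labels the edges leaving it, (ii) every variable occurs at most once on every path from the start to the terminal node, and (iii) there are permutations $\pi_1,\dots,\pi_r$ of $\{1,\dots,N\}$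 such that the sequence of the variables read by the successive non-constant layers is a subsequence of $$x_{\pi_1(1)},\dots,x_{\pi_1(N)},\ \dots,\ x_{\pi_r(1)},\dots,x_{\pi_r(N)}.$$ **Theorem.** There are absolute constants $\varepsilon>0$ and $c>0$ such that for every field $F$, every even $N\ge 2$ and all $r,s,m$: if $g=f_1+\dots+f_m$, where each $f_j\in\mathbb G[x_1,\dots,x_N]$ is computed by an $r$-pass multilinear ABP of size at most $s$, then $$m\ \ge\ \frac{2^{\varepsilon N^{1/5}}}{s^{\,c\,(r+\log_2 N)}}.$$ -/

import Mathlib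

/-- A (layered) algebraic branching program over the variables `σ` and the field `K`.
The nodes are `Fin size`, distributed over the layers `0, …, len`; every edge goes from some layer
to the next one and is labelled by a variable or by a constant.  Parallel edges are allowed. -/
structure ABP (σ K : Type*) where
  /-- the number of nodes -/
  size : ℕ
  /-- the index of the last layer -/
  len : ℕ
  /-- the number of edges -/
  numEdges : ℕ
  layer : Fin size → Fin (len + 1)
  src : Fin numEdges → Fin size
  tgt : Fin numEdges → Fin size
  label : Fin numEdges → σ ⊕ K
  layer_tgt : ∀ e, (layer (tgt e) : ℕ) = layer (src e) + 1
  /-- the start node -/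
  start : Fin size
  /-- the terminal node -/
  term : Fin size
  layer_start : layer start = 0
  layer_term : layer term = Fin.last len

namespace ABP

/-- The nodes `u 0, …, u len` and the edges `e 0, …, e (len - 1)` form a path from the start node
to the terminal node. -/
def IsPath {σ K : Type*} (P : ABP σ K) (u : Fin (P.len + 1) → Fin P.size)
    (e : Fin P.len → Fin P.numEdges) : Prop :=
  u 0 = P.start ∧ u (Fin.last P.len) = P.term ∧
    ∀ i : Fin P.len, P.src (e i) = u i.castSucc ∧ P.tgt (e i) = u i.succ

/-- The label of an edge, as a polynomial. -/
noncomputable def edgePoly {σ K : Type*} [Field K] (P : ABP σ K) (e : Fin P.numEdges) :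
    MvPolynomial σ K :=
  Sum.elim MvPolynomial.X MvPolynomial.C (P.label e)

open Classical in
/-- The polynomial computed by `P`: the sum, over all paths from the start node to the terminal
node, of the product of the edge labels. -/
noncomputable def poly {σ K : Type*} [Field K] (P : ABP σ K) : MvPolynomial σ K :=
  ∑ p : (Fin (P.len + 1) → Fin P.size) × (Fin P.len → Fin P.numEdges) with P.IsPath p.1 p.2,
    ∏ i, P.edgePoly (p.2 i)

/-- Every variable occurs at most once on every path from the start to the terminal node. -/
def IsSyntacticMultilinear {σ K : Type*} (P : ABP σ K) : Prop :=
  ∀ u e, P.IsPath u e → ∀ (x : σ) (i i' : Fin P.len),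
    P.label (e i) = Sum.inl x → P.label (e i') = Sum.inl x → i = i'

/-- `v` lists, layer by layer, the only variable that may label the edges leaving that layer
(`none` for a layer whose outgoing edges are all labelled by constants). -/
def Reads {σ K : Type*} (P : ABP σ K) (v : Fin P.len → Option σ) : Prop :=
  ∀ (i : Fin P.len) (e : Fin P.numEdges) (x : σ),
    P.layer (P.src e) = i.castSucc → P.label e = Sum.inl x → v i = some x

/-- For every layer there is at most one variable that labels edges from that layer. -/
def IsOblivious {σ K : Type*} (P : ABP σ K) : Prop :=
  ∃ v, P.Reads v

/-- `P` is an `r`-pass multilinear ABP: it is oblivious and syntactic multilinear, and there are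
permutations `π 0, …, π (r - 1)` such that the variables read by the successive non-constant layers
appear in the order `x_{π 0 (0)}, …, x_{π 0 (N-1)}, …, x_{π (r-1) (0)}, …, x_{π (r-1) (N-1)}`.
A pass may skip variables, so a `1`-pass multilinear ABP is the same as a read-once oblivious ABP,
in which every variable appears in at most one layer. -/
def IsRPassMultilinear {N : ℕ} {K : Type*} (r : ℕ) (P : ABP (Fin N) K) : Prop :=
  P.IsOblivious ∧ P.IsSyntacticMultilinear ∧
    ∃ (π : Fin r → Equiv.Perm (Fin N)) (v : Fin P.len → Option (Fin N)), P.Reads v ∧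
      (List.ofFn v).reduceOption.Sublist (List.ofFn fun a : Fin r => List.ofFn (π a)).flatten

end ABP

/-- The recursion of Raz and Yehudayoff, for given elements `x i` and `w i k j` of a ring:
`g_{i,j} = 1` if the interval `[i,j]` is empty, and otherwise
`g_{i,j} = (1 + x_i x_j) g_{i+1,j-1} + ∑ k, w_{i,k,j} g_{i,k} g_{k+1,j}`, where `k` ranges over
those elements of `[i+1,j-2]` for which `|[i,k]| = k + 1 - i` is even.
It is only meaningful for `1 ≤ i` and `|[i,j]|` even. -/
def razYehudayoffRec {R : Type*} [CommRing R] (x : ℕ → R) (w : ℕ → ℕ → ℕ → R) (i j : ℕ) : R :=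
  if j < i then 1
  else
    (1 + x i * x j) * razYehudayoffRec x w (i + 1) (j - 1) +
      ∑ k : {k // k ∈ (Finset.Icc (i + 1) (j - 2)).filter fun k => Even (k + 1 - i)},
        w i k j * razYehudayoffRec x w i k * razYehudayoffRec x w (k + 1) j
termination_by j + 1 - i
decreasing_by
  · omega
  · have := k.2
    simp only [Finset.mem_filter, Finset.mem_Icc] at this
    omega
  · have := k.2
    simp only [Finset.mem_filter, Finset.mem_Icc] at this
    omega

theorem razYehudayoffRec_of_lt {R : Type*} [CommRing R] (x : ℕ → R) (w : ℕ → ℕ → ℕ → R)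
    {i j : ℕ} (h : j < i) : razYehudayoffRec x w i j = 1 := by
  rw [razYehudayoffRec, if_pos h]

theorem razYehudayoffRec_of_le {R : Type*} [CommRing R] (x : ℕ → R) (w : ℕ → ℕ → ℕ → R)
    {i j : ℕ} (h : i ≤ j) : razYehudayoffRec x w i j =
      (1 + x i * x j) * razYehudayoffRec x w (i + 1) (j - 1) +
        ∑ k ∈ Finset.Icc (i + 1) (j - 2) with Even (k + 1 - i),
          w i k j * razYehudayoffRec x w i k * razYehudayoffRec x w (k + 1) j := by
  rw [razYehudayoffRec, if_neg (not_lt.mpr h)]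
  congr 1
  exact Finset.sum_coe_sort ((Finset.Icc (i + 1) (j - 2)).filter fun k => Even (k + 1 - i))
    (fun k => w i k j * razYehudayoffRec x w i k * razYehudayoffRec x w (k + 1) j)

/-- The rational function field `F(W)`, `W = {w_{i,k,j} : i, k, j ∈ [N]}`. -/
abbrev RYField (F : Type*) [Field F] (N : ℕ) : Type _ :=
  FractionRing (MvPolynomial (Fin N × Fin N × Fin N) F)

/-- The variable `x_i`, `1 ≤ i ≤ N`. -/
noncomputable def ryX (F : Type*) [Field F] (N i : ℕ) : MvPolynomial (Fin N) (RYField F N) :=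
  if h : 1 ≤ i ∧ i ≤ N then MvPolynomial.X ⟨i - 1, by omega⟩ else 0

/-- The element `w_{i,k,j}` of `F(W)`, `1 ≤ i, k, j ≤ N`, as a constant polynomial. -/
noncomputable def ryW (F : Type*) [Field F] (N i k j : ℕ) : MvPolynomial (Fin N) (RYField F N) :=
  if h : (1 ≤ i ∧ i ≤ N) ∧ (1 ≤ k ∧ k ≤ N) ∧ (1 ≤ j ∧ j ≤ N) then
    MvPolynomial.C (algebraMap (MvPolynomial (Fin N × Fin N × Fin N) F) (RYField F N)
      (MvPolynomial.X (⟨i - 1, by omega⟩, ⟨k - 1, by omega⟩, ⟨j - 1, by omega⟩)))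
  else 0

/-- The Raz–Yehudayoff polynomial `g = g_{1,N}` in `F(W)[x_1, …, x_N]`. -/
noncomputable def razYehudayoff (F : Type*) [Field F] (N : ℕ) :
    MvPolynomial (Fin N) (RYField F N) :=
  razYehudayoffRec (ryX F N) (ryW F N) 1 N

/-! ### Split rank: the rank of a function of 0-1 points across a partition of the variables. -/

section SplitRank

open Finset

/-! All polynomials are evaluated at 0-1 points and viewed as functions of a set `A`; for a set `S`
of variables, such a function is a matrix with rows indexed by `A ∩ S` and columns by `A \ S`. The
proof compares the ranks of these matrices (`HasSplitRank`).

Write `N = 2n`. For every `S` of size `n` the matrix of `g` is invertible, so its rank is `2^n`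
(`two_pow_le_of_hasSplitRank_razYehudayoff`): for a given `S` the weights `w` can be specialized, by
induction on the interval, so that the determinant does not vanish.

An `r`-pass multilinear ABP of size `s` is a sum of at most `s^r` read-once programs, one for each
choice of nodes at the ends of the passes (`ABP.hasSplitRank_cut`). Cut the order of a read-once
program into `q` blocks of size `2a` and a remainder. Summing over the nodes between blocks bounds
the rank by `s^(q+1)` times the product of the `2^min(|B ∩ S|, |B \ S|)` over the blocks `B`
(`hasSplitRank_readOnce`). In a block of size `2a` this minimum is `a` minus the imbalance of `S`.

A random `S` typically has imbalance of order `√a` in a block. With `a = 128 h²`, total imbalance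
below `q h` has probability at most `2^(-q)`, whereas balanced sets have density at least `1/(2n)`.
If `2^q > m s^r N`, some balanced `S` is therefore uneven for all `m s^r` orders at once
(`exists_balanced_le_sum_dist`), and `2^n ≤ m s^r s^(q+1) 2^(n - q h)`. Taking `2^h ≥ 2s` turns this
into `2^q ≤ m s^(r+1)`. The theorem follows with `h` about `log s` and `q` about `N / (256 h²)`. -/

theorem Finset.sum_powerset_union_of_disjoint {α M : Type*} [DecidableEq α] [AddCommMonoid M]
    {s t : Finset α} (hst : Disjoint s t) (f : Finset α → M) :
    ∑ A ∈ (s ∪ t).powerset, f A = ∑ B ∈ s.powerset, ∑ C ∈ t.powerset, f (B ∪ C) := by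
  rw [← Finset.sum_product']
  refine Finset.sum_bij' (fun A _ => (A ∩ s, A ∩ t)) (fun p _ => p.1 ∪ p.2) ?_ ?_ ?_ ?_ ?_
  · intro A _
    simp [inter_subset_right]
  · rintro ⟨B, C⟩ h
    simp only [mem_product, mem_powerset] at h ⊢
    exact union_subset_union h.1 h.2
  · intro A h
    simp only [mem_powerset] at h
    rw [← inter_union_distrib_left, inter_eq_left.2 h]
  · rintro ⟨B, C⟩ h
    simp only [mem_product, mem_powerset] at h
    have h1 : C ∩ s = ∅ := disjoint_iff_inter_eq_empty.1 (hst.symm.mono_left h.2)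
    have h2 : B ∩ t = ∅ := disjoint_iff_inter_eq_empty.1 (hst.mono_left h.1)
    simp [union_inter_distrib_right, h1, h2, inter_eq_left.2 h.1, inter_eq_left.2 h.2]
  · intro A h
    simp only [mem_powerset] at h
    rw [← inter_union_distrib_left, inter_eq_left.2 h]

/-- `h` is a sum of at most `T` products of a function of the coordinates in `S` and a function
of the coordinates outside `S`. -/
def HasSplitRank {α K : Type*} [DecidableEq α] [CommSemiring K] (S : Finset α) (T : ℕ)
    (h : Finset α → K) : Prop :=
  ∃ a b : Fin T → Finset α → K, ∀ A, h A = ∑ t, a t (A ∩ S) * b t (A \ S)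

namespace HasSplitRank

variable {α K : Type*} [DecidableEq α] [CommSemiring K] {S : Finset α}

theorem of_fintype {ι : Type*} [Fintype ι] {T : ℕ} (hT : Fintype.card ι ≤ T) {h : Finset α → K}
    (a b : ι → Finset α → K) (hab : ∀ A, h A = ∑ t, a t (A ∩ S) * b t (A \ S)) :
    HasSplitRank S T h := by
  classical
  obtain ⟨g⟩ : Nonempty (ι ↪ Fin T) := Function.Embedding.nonempty_of_card_le (by simpa using hT)
  refine ⟨fun t A => ∑ i, if g i = t then a i A else 0,
    fun t A => ∑ i, if g i = t then b i A else 0, fun A => ?_⟩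
  rw [hab]
  have key : ∀ (f : ι → K) (i : ι), (∑ j, if g j = g i then f j else 0) = f i := by
    intro f i
    simp
  symm
  rw [← Finset.sum_subset (Finset.subset_univ (Finset.univ.map g))]
  · rw [Finset.sum_map]
    refine Finset.sum_congr rfl fun i _ => ?_
    beta_reduce
    rw [key, key]
  · intro t _ ht
    beta_reduce
    rw [Finset.sum_eq_zero, zero_mul]
    intro i _
    rw [if_neg]
    rintro rfl
    exact ht (by simp)

theorem mono {T T' : ℕ} {h : Finset α → K} (hT : T ≤ T') (hh : HasSplitRank S T h) :
    HasSplitRank S T' h := by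
  obtain ⟨a, b, hab⟩ := hh
  exact of_fintype (by simpa using hT) a b hab

theorem sum {ι : Type*} [Fintype ι] {T : ι → ℕ} {h : ι → Finset α → K}
    (hh : ∀ i, HasSplitRank S (T i) (h i)) :
    HasSplitRank S (∑ i, T i) (fun A => ∑ i, h i A) := by
  choose a b hab using hh
  refine of_fintype (ι := Σ i, Fin (T i)) (by simp) (fun p => a p.1 p.2) (fun p => b p.1 p.2)
    fun A => ?_
  rw [Fintype.sum_sigma]
  exact Finset.sum_congr rfl fun i _ => hab i A

theorem sum_const {ι : Type*} [Fintype ι] {T : ℕ} {h : ι → Finset α → K}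
    (hh : ∀ i, HasSplitRank S T (h i)) :
    HasSplitRank S (Fintype.card ι * T) (fun A => ∑ i, h i A) := by
  simpa using sum hh

theorem mul {T T' : ℕ} {h h' : Finset α → K} (hh : HasSplitRank S T h)
    (hh' : HasSplitRank S T' h') : HasSplitRank S (T * T') (fun A => h A * h' A) := by
  obtain ⟨a, b, hab⟩ := hh
  obtain ⟨a', b', hab'⟩ := hh'
  refine of_fintype (ι := Fin T × Fin T') (by simp) (fun p A => a p.1 A * a' p.2 A)
    (fun p A => b p.1 A * b' p.2 A) fun A => ?_
  rw [hab, hab', Finset.sum_mul_sum, ← Finset.univ_product_univ, Finset.sum_product]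
  exact Finset.sum_congr rfl fun i _ => Finset.sum_congr rfl fun j _ => by ring

theorem const (c : K) : HasSplitRank S 1 (fun _ => c) :=
  ⟨fun _ _ => c, fun _ _ => 1, fun _ => by simp⟩

/-- Expand in the indicators of the restrictions of `A` to the smaller of the two sides of `B`; each
restriction contributes one product. -/
theorem of_dependsOn {B : Finset α} {h : Finset α → K} (hB : ∀ A, h A = h (A ∩ B)) :
    HasSplitRank S (2 ^ min #(B ∩ S) #(B \ S)) h := by
  have hA : ∀ A, A ∩ B = (A ∩ S ∩ B) ∪ (A \ S ∩ B) := by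
    intro A
    ext x
    simp only [mem_inter, mem_union, mem_sdiff]
    tauto
  rcases min_choice #(B ∩ S) #(B \ S) with h1 | h1 <;> rw [h1]
  · refine of_fintype (ι := (B ∩ S).powerset) (by rw [Fintype.card_coe, card_powerset])
      (fun C A => if A ∩ B = C then 1 else 0) (fun C A => h (C ∪ (A ∩ B))) fun A => ?_
    have hm : A ∩ S ∩ B ∈ (B ∩ S).powerset := by
      rw [mem_powerset]
      intro x
      simp only [mem_inter]
      tauto
    rw [Finset.sum_eq_single ⟨_, hm⟩]
    · rw [if_pos rfl, one_mul, hB A, hA A]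
    · intro C _ hC
      rw [if_neg fun h => hC (Subtype.ext h.symm), zero_mul]
    · simp
  · refine of_fintype (ι := (B \ S).powerset) (by rw [Fintype.card_coe, card_powerset])
      (fun C A => h ((A ∩ B) ∪ C)) (fun C A => if A ∩ B = C then 1 else 0) fun A => ?_
    have hm : A \ S ∩ B ∈ (B \ S).powerset := by
      rw [mem_powerset]
      intro x
      simp only [mem_inter, mem_sdiff]
      tauto
    rw [Finset.sum_eq_single ⟨_, hm⟩]
    · rw [if_pos rfl, mul_one, hB A, hA A]
    · intro C _ hC
      rw [if_neg fun h => hC (Subtype.ext h.symm), mul_zero]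
    · simp

end HasSplitRank

/-! ### Imbalance of random subsets -/

/-- Independence of the traces of a uniform random set on disjoint blocks. The factor `2 ^ #R₀`
counts the free choices outside the blocks. -/
theorem Finset.sum_powerset_prod_inter {α ι R : Type*} [DecidableEq α] [DecidableEq ι]
    [CommSemiring R] (J : Finset ι) (B : ι → Finset α) (R₀ : Finset α)
    (hB : (J : Set ι).PairwiseDisjoint B) (hR : ∀ j ∈ J, Disjoint (B j) R₀)
    (f : ι → Finset α → R) :
    ∑ S ∈ (J.biUnion B ∪ R₀).powerset, ∏ j ∈ J, f j (S ∩ B j) =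
      2 ^ #R₀ * ∏ j ∈ J, ∑ C ∈ (B j).powerset, f j C := by
  induction J using Finset.induction_on with
  | empty => simp
  | insert i J hi ih =>
    have hdisj : Disjoint (B i) (J.biUnion B ∪ R₀) := by
      rw [disjoint_union_right, disjoint_biUnion_right]
      refine ⟨fun j hj => hB (by simp) (by simp [hj]) ?_, hR i (by simp)⟩
      rintro rfl
      exact hi hj
    rw [biUnion_insert, union_assoc, sum_powerset_union_of_disjoint hdisj, prod_insert hi,
      mul_left_comm, ← ih (hB.subset (by simp)) fun j hj => hR j (by simp [hj]), Finset.sum_mul_sum]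
    refine sum_congr rfl fun C hC => sum_congr rfl fun D hD => ?_
    rw [mem_powerset] at hC hD
    have h1 : D ∩ B i = ∅ := disjoint_iff_inter_eq_empty.1 (hdisj.symm.mono_left hD)
    rw [prod_insert hi, union_inter_distrib_right, inter_eq_left.2 hC, h1, union_empty]
    congr 1
    refine prod_congr rfl fun j hj => ?_
    have h2 : C ∩ B j = ∅ := by
      refine disjoint_iff_inter_eq_empty.1 (Disjoint.mono_left hC
        (hB (by simp) (by simp [hj]) ?_))
      rintro rfl
      exact hi hj
    rw [union_inter_distrib_right, h2, empty_union]

/-- The bound `4^n / √(2n+1)`, squared to stay in `ℕ`. The induction rests on `(2n+1)(2n+3) ≤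
4(n+1)²`. -/
theorem Nat.centralBinom_sq_mul_le (n : ℕ) : n.centralBinom ^ 2 * (2 * n + 1) ≤ 16 ^ n := by
  induction n with
  | zero => simp
  | succ n ih =>
    have h := Nat.succ_mul_centralBinom_succ n
    have h2 : (n + 1) ^ 2 * ((n + 1).centralBinom ^ 2 * (2 * (n + 1) + 1)) ≤
        (n + 1) ^ 2 * 16 ^ (n + 1) := by
      calc (n + 1) ^ 2 * ((n + 1).centralBinom ^ 2 * (2 * (n + 1) + 1))
          = ((n + 1) * (n + 1).centralBinom) ^ 2 * (2 * (n + 1) + 1) := by ring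
        _ = (n.centralBinom ^ 2 * (2 * n + 1)) * (4 * ((2 * n + 1) * (2 * n + 3))) := by
          rw [h]; ring
        _ ≤ 16 ^ n * (4 * (4 * (n + 1) ^ 2)) :=
          Nat.mul_le_mul ih (Nat.mul_le_mul_left _ (by nlinarith))
        _ = _ := by ring
    exact Nat.le_of_mul_le_mul_left h2 (by positivity)

theorem sum_range_pow_dist_le {ρ : ℝ} (h0 : 0 ≤ ρ) (h1 : ρ < 1) (a : ℕ) :
    ∑ k ∈ range (2 * a + 1), ρ ^ Nat.dist k a ≤ 2 * (1 - ρ)⁻¹ := by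
  have hg : ∀ n, ∑ i ∈ range n, ρ ^ i ≤ (1 - ρ)⁻¹ := fun n => by
    rw [← tsum_geometric_of_lt_one h0 h1]
    exact (summable_geometric_of_lt_one h0 h1).sum_le_tsum _ fun i _ => pow_nonneg h0 i
  rw [show 2 * a + 1 = a + (a + 1) by ring, sum_range_add, two_mul]
  gcongr
  · rw [← sum_range_reflect]
    refine le_trans (sum_le_sum fun k hk => ?_) (hg a)
    rw [mem_range] at hk
    refine pow_le_pow_of_le_one h0 h1.le ?_
    rw [Nat.dist]
    omega
  · refine le_trans (sum_le_sum fun k hk => ?_) (hg (a + 1))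
    refine pow_le_pow_of_le_one h0 h1.le ?_
    rw [Nat.dist]
    omega

/-- An exponential moment of the imbalance. Since `2a = (16h)²`, every binomial probability is at
most `1/(16h)`, and the two-sided geometric series with ratio `1 - 1/(2h)` sums to at most `4h`. -/
theorem sum_powerset_pow_dist_le {α : Type*} {B : Finset α} {a h : ℕ} (hh : 1 ≤ h)
    (ha : a = 128 * h ^ 2) (hB : #B = 2 * a) :
    ∑ C ∈ B.powerset, (1 - 1 / (2 * h : ℝ)) ^ Nat.dist #C a ≤ 2 ^ (2 * a) / 4 := by
  have hh' : (1 : ℝ) ≤ h := by exact_mod_cast hh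
  set ρ : ℝ := 1 - 1 / (2 * h : ℝ) with hρ
  have hlt : ρ < 1 := by
    have : 0 < 1 / (2 * h : ℝ) := by positivity
    linarith
  have h0 : 0 ≤ ρ := by
    have : 1 / (2 * h : ℝ) ≤ 1 := by
      rw [div_le_one (by positivity)]
      linarith
    linarith
  have hinv : (1 - ρ)⁻¹ = 2 * h := by
    rw [hρ]
    field_simp
    ring
  have hc : (a.centralBinom : ℝ) * (16 * h) ≤ 4 ^ a := by
    refine le_of_sq_le_sq ?_ (by positivity)
    have h1 : ((a.centralBinom ^ 2 * (2 * a + 1) : ℕ) : ℝ) ≤ ((16 ^ a : ℕ) : ℝ) :=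
      Nat.cast_le.2 a.centralBinom_sq_mul_le
    have h2 : (a : ℝ) = 128 * h ^ 2 := by exact_mod_cast ha
    push_cast at h1
    calc ((a.centralBinom : ℝ) * (16 * h)) ^ 2 = (a.centralBinom : ℝ) ^ 2 * (2 * a) := by
          rw [h2]; ring
      _ ≤ (a.centralBinom : ℝ) ^ 2 * (2 * a + 1) := by gcongr; linarith
      _ ≤ 16 ^ a := h1
      _ = (4 ^ a) ^ 2 := by rw [← pow_mul, mul_comm, pow_mul]; norm_num
  rw [sum_powerset_apply_card (fun k => ρ ^ Nat.dist k a), hB]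
  calc ∑ m ∈ range (2 * a + 1), (2 * a).choose m • ρ ^ Nat.dist m a
      ≤ ∑ m ∈ range (2 * a + 1), (a.centralBinom : ℝ) * ρ ^ Nat.dist m a := by
        refine sum_le_sum fun m _ => ?_
        rw [nsmul_eq_mul]
        gcongr
        exact Nat.choose_le_centralBinom m a
    _ ≤ (a.centralBinom : ℝ) * (2 * (2 * h)) := by
        rw [← mul_sum, ← hinv]
        gcongr
        exact sum_range_pow_dist_le h0 hlt a
    _ = (a.centralBinom : ℝ) * (16 * h) / 4 := by ring
    _ ≤ 4 ^ a / 4 := by gcongr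
    _ = 2 ^ (2 * a) / 4 := by rw [pow_mul]; norm_num

/-- Few subsets `S` split each of `q` disjoint blocks of size `2 a` nearly evenly. -/
theorem card_filter_sum_dist_lt_le {α : Type*} [Fintype α] [DecidableEq α] {q a h : ℕ}
    (hh : 1 ≤ h) (ha : a = 128 * h ^ 2) (B : Fin q → Finset α)
    (hB : Pairwise fun i j => Disjoint (B i) (B j)) (hcard : ∀ j, #(B j) = 2 * a) :
    2 ^ q * #{S : Finset α | ∑ j, Nat.dist #(S ∩ B j) a < q * h} ≤ 2 ^ Fintype.card α := by
  have hh' : (1 : ℝ) ≤ h := by exact_mod_cast hh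
  set ρ : ℝ := 1 - 1 / (2 * h : ℝ) with hρ
  have hlt : ρ ≤ 1 := by
    have : 0 < 1 / (2 * h : ℝ) := by positivity
    linarith
  -- Bernoulli's inequality.
  have hρh : 1 / 2 ≤ ρ ^ h := by
    have := one_add_mul_le_pow (a := -(1 / (2 * h : ℝ))) (by
      have : 1 / (2 * h : ℝ) ≤ 1 := by
        rw [div_le_one (by positivity)]
        linarith
      linarith) h
    rw [← sub_eq_add_neg] at this
    refine le_trans (le_of_eq ?_) this
    field_simp
    norm_num
  have h0 : 0 ≤ ρ := by
    have : 1 / (2 * h : ℝ) ≤ 1 := by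
      rw [div_le_one (by positivity)]
      linarith
    linarith
  set R₀ : Finset α := univ \ univ.biUnion B with hR₀
  have hun : (univ.biUnion B ∪ R₀) = univ := by simp [hR₀]
  have hcardU : #(univ.biUnion B) = q * (2 * a) := by
    rw [card_biUnion fun i _ j _ hij => hB hij]
    simp [hcard]
  have hcardR : q * (2 * a) + #R₀ = Fintype.card α := by
    rw [← hcardU, ← card_union_of_disjoint disjoint_sdiff, hun, card_univ]
  have hsum := sum_powerset_prod_inter (univ : Finset (Fin q)) B R₀
    (fun i _ j _ hij => hB hij) (fun j _ => disjoint_sdiff.mono_left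
      (subset_biUnion_of_mem B (mem_univ j))) (fun _ C => ρ ^ Nat.dist #C a)
  rw [hun, powerset_univ] at hsum
  -- Markov's inequality: every counted `S` has weight at least `ρ^(qh) ≥ 2^(-q)`, while the mean
  -- weight is at most `4^(-q)`.
  have hlow : (1 / 2 : ℝ) ^ q * #{S : Finset α | ∑ j, Nat.dist #(S ∩ B j) a < q * h} ≤
      ∑ S : Finset α, ∏ j, ρ ^ Nat.dist #(S ∩ B j) a := by
    calc (1 / 2 : ℝ) ^ q * #{S : Finset α | ∑ j, Nat.dist #(S ∩ B j) a < q * h}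
        = ∑ S : Finset α with ∑ j, Nat.dist #(S ∩ B j) a < q * h, (1 / 2 : ℝ) ^ q := by
          rw [sum_const, nsmul_eq_mul, mul_comm]
      _ ≤ ∑ S : Finset α with ∑ j, Nat.dist #(S ∩ B j) a < q * h,
            ∏ j, ρ ^ Nat.dist #(S ∩ B j) a := by
          refine sum_le_sum fun S hS => ?_
          rw [mem_filter] at hS
          rw [prod_pow_eq_pow_sum]
          calc (1 / 2 : ℝ) ^ q ≤ (ρ ^ h) ^ q := by gcongr
            _ = ρ ^ (q * h) := by rw [← pow_mul, mul_comm]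
            _ ≤ _ := pow_le_pow_of_le_one h0 hlt hS.2.le
      _ ≤ _ := sum_le_sum_of_subset_of_nonneg (filter_subset _ _) fun S _ _ =>
          prod_nonneg fun j _ => pow_nonneg h0 _
  have hup : ∑ S : Finset α, ∏ j, ρ ^ Nat.dist #(S ∩ B j) a ≤
      2 ^ Fintype.card α * (1 / 4 : ℝ) ^ q := by
    rw [hsum]
    calc (2 : ℝ) ^ #R₀ * ∏ j, ∑ C ∈ (B j).powerset, ρ ^ Nat.dist #C a
        ≤ 2 ^ #R₀ * ∏ _j : Fin q, (2 ^ (2 * a) / 4) := by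
          gcongr with j
          exact sum_powerset_pow_dist_le hh ha (hcard j)
      _ = 2 ^ Fintype.card α * (1 / 4 : ℝ) ^ q := by
          rw [← hcardR, prod_const, card_univ, Fintype.card_fin, div_pow, pow_add,
            pow_mul _ _ q |>.symm.trans (by rw [mul_comm])]
          rw [div_pow, one_pow]
          ring
  have h3 := hlow.trans hup
  have h4 : (2 : ℝ) ^ q * #{S : Finset α | ∑ j, Nat.dist #(S ∩ B j) a < q * h} ≤
      2 ^ Fintype.card α := by
    have h5 := mul_le_mul_of_nonneg_left h3 (show (0 : ℝ) ≤ 4 ^ q by positivity)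
    have e1 : (4 : ℝ) ^ q * (1 / 2) ^ q = 2 ^ q := by rw [← mul_pow]; norm_num
    have e2 : (4 : ℝ) ^ q * (1 / 4) ^ q = 1 := by rw [← mul_pow]; norm_num
    rw [← mul_assoc, e1, mul_left_comm, e2, mul_one] at h5
    exact h5
  exact_mod_cast h4

/-- A balanced set that splits the blocks of each of `M` families unevenly. -/
theorem exists_balanced_le_sum_dist {α ι : Type*} [Fintype α] [DecidableEq α] [Fintype ι]
    {n q a h : ℕ} (hn : 0 < n) (hα : Fintype.card α = 2 * n)
    (hh : 1 ≤ h) (ha : a = 128 * h ^ 2) (B : ι → Fin q → Finset α)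
    (hB : ∀ t, Pairwise fun i j => Disjoint (B t i) (B t j)) (hcard : ∀ t j, #(B t j) = 2 * a)
    (hM : Fintype.card ι * (2 * n) < 2 ^ q) :
    ∃ S : Finset α, #S = n ∧ ∀ t, q * h ≤ ∑ j, Nat.dist #(S ∩ B t j) a := by
  by_contra! hcon
  -- Union bound: otherwise the bad sets of the families cover all balanced sets, of which there are
  -- at least `4^n / (2n)`.
  have hsub : powersetCard n (univ : Finset α) ⊆
      univ.biUnion fun t => {S : Finset α | ∑ j, Nat.dist #(S ∩ B t j) a < q * h} := by
    intro S hS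
    obtain ⟨t, ht⟩ := hcon S (mem_powersetCard.1 hS).2
    simp only [mem_biUnion, mem_univ, true_and, mem_filter]
    exact ⟨t, ht⟩
  have h1 := (card_le_card hsub).trans card_biUnion_le
  rw [card_powersetCard, card_univ, hα, ← Nat.centralBinom_eq_two_mul_choose] at h1
  have h2 : 2 ^ q * n.centralBinom ≤ Fintype.card ι * 4 ^ n := by
    calc 2 ^ q * n.centralBinom ≤
        ∑ t, 2 ^ q * #{S : Finset α | ∑ j, Nat.dist #(S ∩ B t j) a < q * h} := by
          rw [← mul_sum]
          exact Nat.mul_le_mul_left _ h1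
      _ ≤ ∑ _t : ι, 2 ^ (2 * n) := by
          refine sum_le_sum fun t _ => ?_
          rw [← hα]
          exact card_filter_sum_dist_lt_le hh ha (B t) (hB t) (hcard t)
      _ = Fintype.card ι * 4 ^ n := by
          rw [sum_const, card_univ, smul_eq_mul, pow_mul]
          norm_num
  have h3 := Nat.four_pow_le_two_mul_self_mul_centralBinom n hn
  have h4 : 2 ^ q * n.centralBinom ≤ (Fintype.card ι * (2 * n)) * n.centralBinom := by
    calc _ ≤ _ := h2
      _ ≤ Fintype.card ι * (2 * n * n.centralBinom) := Nat.mul_le_mul_left _ h3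
      _ = _ := by ring
  exact absurd (Nat.le_of_mul_le_mul_right h4 n.centralBinom_pos) (not_le.2 hM)

end SplitRank

/-! ### Full rank of the Raz–Yehudayoff polynomial across every balanced partition. -/

section RazYehudayoff

open Finset

theorem map_razYehudayoffRec {R R' : Type*} [CommRing R] [CommRing R'] (φ : R →+* R')
    (x : ℕ → R) (w : ℕ → ℕ → ℕ → R) (i j : ℕ) :
    φ (razYehudayoffRec x w i j) =
      razYehudayoffRec (fun k => φ (x k)) (fun a b c => φ (w a b c)) i j := by
  induction hn : j + 1 - i using Nat.strong_induction_on generalizing i j with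
  | _ n ih =>
    subst hn
    rcases lt_or_ge j i with h | h
    · rw [razYehudayoffRec_of_lt _ _ h, razYehudayoffRec_of_lt _ _ h, map_one]
    · rw [razYehudayoffRec_of_le _ _ h, razYehudayoffRec_of_le _ _ h, map_add, map_mul, map_add,
        map_mul, map_one, map_sum, ih _ (by omega) (i + 1) (j - 1) rfl]
      congr 1
      refine sum_congr rfl fun k hk => ?_
      simp only [mem_filter, mem_Icc] at hk
      rw [map_mul, map_mul, ih _ (by omega) i k rfl, ih _ (by omega) (k + 1) j rfl]

theorem razYehudayoffRec_congr {R : Type*} [CommRing R] {x x' : ℕ → R} {w w' : ℕ → ℕ → ℕ → R}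
    {i j : ℕ} (hx : ∀ k, i ≤ k → k ≤ j → x k = x' k)
    (hw : ∀ a b c, i ≤ a → a ≤ b → b ≤ c → c ≤ j → w a b c = w' a b c) :
    razYehudayoffRec x w i j = razYehudayoffRec x' w' i j := by
  induction hn : j + 1 - i using Nat.strong_induction_on generalizing i j with
  | _ n ih =>
    subst hn
    rcases lt_or_ge j i with h | h
    · rw [razYehudayoffRec_of_lt _ _ h, razYehudayoffRec_of_lt _ _ h]
    · rw [razYehudayoffRec_of_le _ _ h, razYehudayoffRec_of_le _ _ h, hx i le_rfl h,
        hx j h le_rfl, ih _ (by omega) (i := i + 1) (j := j - 1)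
          (fun k h1 h2 => hx k (by omega) (by omega))
          (fun a b c h1 h2 h3 h4 => hw a b c (by omega) h2 h3 (by omega)) rfl]
      congr 1
      refine sum_congr rfl fun k hk => ?_
      simp only [mem_filter, mem_Icc] at hk
      rw [hw i k j le_rfl (by omega) (by omega) le_rfl,
        ih _ (by omega) (i := i) (j := k)
          (fun k h1 h2 => hx k (by omega) (by omega))
          (fun a b c h1 h2 h3 h4 => hw a b c (by omega) h2 h3 (by omega)) rfl,
        ih _ (by omega) (i := k + 1) (j := j)
          (fun k h1 h2 => hx k (by omega) (by omega))
          (fun a b c h1 h2 h3 h4 => hw a b c (by omega) h2 h3 (by omega)) rfl]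

/-- The matrix `(h (A ∪ B))`, `A ⊆ Y`, `B ⊆ Z`, has trivial kernel. -/
def NondegenerateOn {α K : Type*} [DecidableEq α] [CommSemiring K] (Y Z : Finset α)
    (h : Finset α → K) : Prop :=
  ∀ u : Finset α → K, (∀ A ⊆ Y, ∑ B ∈ Z.powerset, h (A ∪ B) * u B = 0) → ∀ B ⊆ Z, u B = 0

/-- The matrix `(h (A ∪ B))`, `A ⊆ Y`, `B ⊆ Z`, its rows being indexed by means of `e`. -/
def splitMatrix {α K : Type*} [DecidableEq α] {Y Z : Finset α} (e : Z.powerset ≃ Y.powerset)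
    (h : Finset α → K) : Matrix Z.powerset Z.powerset K :=
  Matrix.of fun A B => h ((e A : Finset α) ∪ B)

theorem nondegenerateOn_iff_det_ne_zero {α K : Type*} [DecidableEq α] [CommRing K] [IsDomain K]
    {Y Z : Finset α} (e : Z.powerset ≃ Y.powerset) (h : Finset α → K) :
    NondegenerateOn Y Z h ↔ (splitMatrix e h).det ≠ 0 := by
  rw [Ne, ← Matrix.exists_mulVec_eq_zero_iff]
  push Not
  constructor
  · intro hh v hv hv0
    apply hv
    have := hh (fun B => if hB : B ∈ Z.powerset then v ⟨B, hB⟩ else 0) (fun A hA => ?_)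
    · ext B
      have h2 := this B (mem_powerset.1 B.2)
      rwa [dif_pos B.2] at h2
    · have h1 := congrFun hv0 (e.symm ⟨A, mem_powerset.2 hA⟩)
      simp only [splitMatrix, Matrix.mulVec, dotProduct, Matrix.of_apply, Equiv.apply_symm_apply,
        Pi.zero_apply] at h1
      rw [← h1, ← sum_coe_sort]
      exact sum_congr rfl fun B _ => by rw [dif_pos B.2]
  · intro hh u hu B hB
    by_contra hne
    refine hh (fun B => u B) (fun h0 => hne (congrFun h0 ⟨B, mem_powerset.2 hB⟩)) ?_
    ext A
    simp only [splitMatrix, Matrix.mulVec, dotProduct, Matrix.of_apply, Pi.zero_apply]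
    rw [← hu (e A) (mem_powerset.1 (e A).2), ← sum_coe_sort Z.powerset]

theorem nonempty_powerset_equiv {α : Type*} {Y Z : Finset α} (h : #Y = #Z) :
    Nonempty (Z.powerset ≃ Y.powerset) :=
  ⟨Fintype.equivOfCardEq (by simp [h])⟩

/-- A determinant that is nonzero after a specialization was nonzero before it. -/
theorem NondegenerateOn.of_map {α K K' : Type*} [DecidableEq α] [CommRing K] [IsDomain K]
    [CommRing K'] [IsDomain K'] {Y Z : Finset α} (hYZ : #Y = #Z) (φ : K →+* K')
    {h : Finset α → K} (hh : NondegenerateOn Y Z fun A => φ (h A)) : NondegenerateOn Y Z h := by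
  obtain ⟨e⟩ := nonempty_powerset_equiv hYZ
  rw [nondegenerateOn_iff_det_ne_zero e] at hh ⊢
  intro h0
  apply hh
  have : splitMatrix e (fun A => φ (h A)) = φ.mapMatrix (splitMatrix e h) := by
    ext A B
    simp [splitMatrix]
  rw [this, ← RingHom.map_det, h0, map_zero]

theorem NondegenerateOn.map {α K K' : Type*} [DecidableEq α] [CommRing K] [IsDomain K]
    [CommRing K'] [IsDomain K'] {Y Z : Finset α} (hYZ : #Y = #Z) {φ : K →+* K'}
    (hφ : Function.Injective φ) {h : Finset α → K} (hh : NondegenerateOn Y Z h) :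
    NondegenerateOn Y Z fun A => φ (h A) := by
  obtain ⟨e⟩ := nonempty_powerset_equiv hYZ
  rw [nondegenerateOn_iff_det_ne_zero e] at hh ⊢
  have : splitMatrix e (fun A => φ (h A)) = φ.mapMatrix (splitMatrix e h) := by
    ext A B
    simp [splitMatrix]
  rw [this, ← RingHom.map_det]
  exact fun h0 => hh (hφ (by rw [h0, map_zero]))

/-- The determinant of `X M + M'` is a polynomial in `X` whose coefficient in degree equal to the
size of the matrices is `det M ≠ 0`; over an infinite field it has a nonroot. -/
theorem NondegenerateOn.exists_smul_add {α K : Type*} [DecidableEq α] [Field K] [Infinite K]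
    {Y Z : Finset α} (hYZ : #Y = #Z) {h : Finset α → K} (hh : NondegenerateOn Y Z h)
    (h' : Finset α → K) : ∃ t : K, NondegenerateOn Y Z fun A => t * h A + h' A := by
  obtain ⟨e⟩ := nonempty_powerset_equiv hYZ
  rw [nondegenerateOn_iff_det_ne_zero e] at hh
  set p : Polynomial K := ((Polynomial.X : Polynomial K) • (splitMatrix e h).map Polynomial.C +
    (splitMatrix e h').map Polynomial.C).det with hp
  have hp0 : p ≠ (0 : Polynomial K) := by
    intro h0
    apply hh
    rw [← Polynomial.coeff_det_X_add_C_card _ (splitMatrix e h'), ← hp, h0, Polynomial.coeff_zero]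
  obtain ⟨t, ht⟩ : ∃ t : K, p.eval t ≠ 0 := by
    by_contra! hcon
    refine hp0 (Polynomial.funext fun t => ?_)
    rw [hcon t, Polynomial.eval_zero]
  refine ⟨t, (nondegenerateOn_iff_det_ne_zero e _).2 ?_⟩
  convert ht using 1
  rw [hp, ← Polynomial.coe_evalRingHom, RingHom.map_det]
  congr 1
  ext A B
  simp [splitMatrix, mul_comm t]

/-- The matrix of a product in separate variables is a Kronecker product; its kernel is killed one
factor at a time. -/
theorem NondegenerateOn.mul {α K : Type*} [DecidableEq α] [CommSemiring K]
    {Y₁ Y₂ Z₁ Z₂ : Finset α} {h h₁ h₂ : Finset α → K}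
    (hh₁ : NondegenerateOn Y₁ Z₁ h₁) (hh₂ : NondegenerateOn Y₂ Z₂ h₂) (hZ : Disjoint Z₁ Z₂)
    (hh : ∀ A₁ ⊆ Y₁, ∀ A₂ ⊆ Y₂, ∀ B₁ ⊆ Z₁, ∀ B₂ ⊆ Z₂,
      h ((A₁ ∪ A₂) ∪ (B₁ ∪ B₂)) = h₁ (A₁ ∪ B₁) * h₂ (A₂ ∪ B₂)) :
    NondegenerateOn (Y₁ ∪ Y₂) (Z₁ ∪ Z₂) h := by
  intro u hu
  have key : ∀ A₂ ⊆ Y₂, ∀ B₁ ⊆ Z₁, ∑ B₂ ∈ Z₂.powerset, h₂ (A₂ ∪ B₂) * u (B₁ ∪ B₂) = 0 := by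
    intro A₂ hA₂
    refine hh₁ (fun B₁ => ∑ B₂ ∈ Z₂.powerset, h₂ (A₂ ∪ B₂) * u (B₁ ∪ B₂)) fun A₁ hA₁ => ?_
    rw [← hu (A₁ ∪ A₂) (union_subset_union hA₁ hA₂), sum_powerset_union_of_disjoint hZ]
    refine sum_congr rfl fun B₁ hB₁ => ?_
    rw [mul_sum]
    refine sum_congr rfl fun B₂ hB₂ => ?_
    rw [hh A₁ hA₁ A₂ hA₂ B₁ (mem_powerset.1 hB₁) B₂ (mem_powerset.1 hB₂), mul_assoc]
  intro B hB
  have h1 : B = (B ∩ Z₁) ∪ (B ∩ Z₂) := by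
    rw [← inter_union_distrib_left, inter_eq_left.2 hB]
  rw [h1]
  exact hh₂ (fun B₂ => u ((B ∩ Z₁) ∪ B₂))
    (fun A₂ hA₂ => key A₂ hA₂ _ inter_subset_right) _ inter_subset_right

/-- The indicator of a set. -/
def zeroOne {α : Type*} [DecidableEq α] (K : Type*) [Zero K] [One K] (A : Finset α) (k : α) : K :=
  if k ∈ A then 1 else 0

theorem nondegenerateOn_one_add_mul {α K : Type*} [DecidableEq α] [CommRing K] {i j : α}
    (hij : i ≠ j) : NondegenerateOn {i} {j} fun A => 1 + zeroOne K A i * zeroOne K A j := by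
  intro u hu
  have hp : ({j} : Finset α).powerset = {∅, {j}} := by
    ext
    simp [subset_singleton_iff]
  have h1 := hu ∅ (by simp)
  have h2 := hu {i} subset_rfl
  rw [hp, sum_pair (singleton_ne_empty j).symm] at h1 h2
  simp only [zeroOne, union_empty, empty_union, mem_singleton, notMem_empty, hij, hij.symm,
    if_true, if_false, mem_union, or_false, or_true] at h1 h2
  have hj : u {j} = 0 := by linear_combination h2 - h1
  have h0 : u ∅ = 0 := by linear_combination h1 - hj
  intro B hB
  rcases subset_singleton_iff.1 hB with rfl | rfl
  exacts [h0, hj]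

/-- A discrete intermediate value theorem. -/
theorem exists_eq_zero_of_sub_le_one {f : ℕ → ℤ} {m n : ℕ} (hmn : m ≤ n)
    (hf : ∀ k, f k ≤ f (k + 1) + 1) (hm : 0 < f m) (hn : f n < 0) :
    ∃ k, m < k ∧ k < n ∧ f k = 0 := by
  have hex : ∃ k, m ≤ k ∧ f k ≤ 0 := ⟨n, hmn, hn.le⟩
  classical
  obtain ⟨h1, h2⟩ := Nat.find_spec hex
  have h3 : Nat.find hex ≤ n := Nat.find_min' hex ⟨hmn, hn.le⟩
  set k := Nat.find hex with hk
  have hkm : m < k := by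
    rcases h1.eq_or_lt with h | h
    · rw [← h] at h2
      omega
    · exact h
  have h4 := Nat.find_min hex (m := k - 1) (by omega)
  have h5 := hf (k - 1)
  rw [Nat.sub_add_cancel (by omega)] at h5
  have h6 : 0 < f (k - 1) := by
    by_contra h
    exact h4 ⟨by omega, by omega⟩
  have h7 : f k = 0 := by omega
  refine ⟨k, hkm, lt_of_le_of_ne h3 ?_, h7⟩
  intro h
  rw [h] at h7
  omega

/-- Walk up at `c` and down otherwise. As the walk ends at `0` and its first and last steps agree,
its values at `i` and `j - 1` have opposite signs, so it vanishes strictly between them. -/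
theorem exists_balanced_prefix {c : ℕ → Prop} [DecidablePred c] {i j : ℕ} (hij : i < j)
    (hbal : #{k ∈ Icc i j | c k} = #{k ∈ Icc i j | ¬ c k}) (hc : c i ↔ c j) :
    ∃ k, i < k ∧ k + 1 < j ∧ #{l ∈ Icc i k | c l} = #{l ∈ Icc i k | ¬ c l} := by
  set f : ℕ → ℤ := fun k => ∑ l ∈ Icc i k, if c l then 1 else -1 with hf
  have hfk : ∀ k, f k = (#{l ∈ Icc i k | c l} : ℤ) - #{l ∈ Icc i k | ¬ c l} := by
    intro k
    simp only [hf]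
    rw [sum_ite]
    simp [sub_eq_add_neg]
  have hstep : ∀ k, i ≤ k + 1 → f (k + 1) = f k + if c (k + 1) then 1 else -1 := by
    intro k hk
    simp only [hf]
    rw [← insert_Icc_right_eq_Icc_add_one hk, sum_insert (by simp), add_comm]
  have hstep' : ∀ k, f (k + 1) ≤ f k + 1 ∧ f k ≤ f (k + 1) + 1 := by
    intro k
    by_cases hk : i ≤ k + 1
    · rw [hstep k hk]
      split_ifs <;> constructor <;> omega
    · simp only [hf]
      rw [Icc_eq_empty (by omega), Icc_eq_empty (by omega)]
      simp
  have hi : f i = if c i then 1 else -1 := by simp [hf]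
  have hj : f j = 0 := by
    rw [hfk, hbal, sub_self]
  have hj1 : f (j - 1) = -if c j then 1 else -1 := by
    have h := hstep (j - 1) (by omega)
    rw [Nat.sub_add_cancel (by omega), hj] at h
    omega
  suffices h : ∃ k, i < k ∧ k < j - 1 ∧ f k = 0 by
    obtain ⟨k, h1, h2, h3⟩ := h
    rw [hfk] at h3
    exact ⟨k, h1, by omega, by omega⟩
  by_cases h : c i
  · rw [if_pos h] at hi
    rw [if_pos (hc.1 h)] at hj1
    exact exists_eq_zero_of_sub_le_one (by omega) (fun k => (hstep' k).2) (by omega) (by omega)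
  · rw [if_neg h] at hi
    rw [if_neg fun h' => h (hc.2 h')] at hj1
    obtain ⟨k, h1, h2, h3⟩ := exists_eq_zero_of_sub_le_one (f := fun k => -f k) (m := i)
      (n := j - 1) (by omega) (fun k => by have := (hstep' k).1; omega) (by omega) (by omega)
    exact ⟨k, h1, h2, by omega⟩

theorem razYehudayoffRec_zeroOne_congr {K : Type*} [CommRing K] {A A' : Finset ℕ}
    {w w' : ℕ → ℕ → ℕ → K} {i j : ℕ} (hA : ∀ k, i ≤ k → k ≤ j → (k ∈ A ↔ k ∈ A'))
    (hw : ∀ a b c, i ≤ a → a ≤ b → b ≤ c → c ≤ j → w a b c = w' a b c) :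
    razYehudayoffRec (zeroOne K A) w i j = razYehudayoffRec (zeroOne K A') w' i j :=
  razYehudayoffRec_congr (fun k h1 h2 => by simp only [zeroOne, hA k h1 h2]) hw

/-- Induction on the interval. If the ends have equal colours, a balanced prefix `[i,k]` exists, and
a suitable value of `w i k j` makes the product term prevail. If they differ, the weights are chosen
to leave only `(1 + x_i x_j) g_{i+1,j-1}`, whose first factor is nondegenerate on the two ends. -/
theorem exists_nondegenerateOn_razYehudayoffRec {K : Type*} [Field K] [Infinite K]
    (c : ℕ → Prop) [DecidablePred c] (i j : ℕ) (hi : 1 ≤ i)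
    (hbal : #{k ∈ Icc i j | c k} = #{k ∈ Icc i j | ¬ c k}) :
    ∃ w : ℕ → ℕ → ℕ → K, NondegenerateOn {k ∈ Icc i j | c k} {k ∈ Icc i j | ¬ c k}
      fun A => razYehudayoffRec (zeroOne K A) w i j := by
  induction hn : j + 1 - i using Nat.strong_induction_on generalizing i j with
  | _ n ih =>
  subst hn
  rcases lt_or_ge j i with h | h
  · refine ⟨0, fun u hu B hB => ?_⟩
    rw [Icc_eq_empty (by omega)] at hB hu
    simp only [filter_empty, subset_empty, powerset_empty, sum_singleton] at hB hu
    have := hu ∅ rfl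
    rw [razYehudayoffRec_of_lt _ _ h, one_mul] at this
    rw [hB, this]
  have hlt : i < j := by
    refine lt_of_le_of_ne h ?_
    rintro rfl
    by_cases hc : c i <;> simp [filter_singleton, hc] at hbal
  have hIcc : Icc i j = insert i (insert j (Icc (i + 1) (j - 1))) := by
    ext k
    simp only [mem_insert, mem_Icc]
    omega
  have hj' : j ∉ Icc (i + 1) (j - 1) := by simp; omega
  by_cases hc : c i ↔ c j
  · obtain ⟨k, hik, hkj, hk⟩ := exists_balanced_prefix hlt hbal hc
    have hsplit : Icc i j = Icc i k ∪ Icc (k + 1) j := by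
      ext l
      simp only [mem_union, mem_Icc]
      omega
    have hdisj : Disjoint (Icc i k) (Icc (k + 1) j) := by
      rw [disjoint_left]
      intro l
      simp only [mem_Icc]
      omega
    have hbal' := hbal
    rw [hsplit, filter_union, filter_union, card_union_of_disjoint
      (disjoint_filter_filter hdisj), card_union_of_disjoint (disjoint_filter_filter hdisj)] at hbal'
    obtain ⟨w₁, hw₁⟩ := ih _ (by omega) i k hi hk rfl
    obtain ⟨w₂, hw₂⟩ := ih _ (by omega) (k + 1) j (by omega) (by omega) rfl
    -- Only the top-level sum sees `t`: within `[i,k]`, `[k+1,j]` and `[i+1,j-1]` no triple has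
    -- outer indices `i` and `j`. Hence the first term of the recursion is the same for `w₀ t` and
    -- `w₀ 0`.
    set w₀ : K → ℕ → ℕ → ℕ → K := fun t a b d =>
      if a = i ∧ d = j then (if b = k then t else 0)
      else if d ≤ k then w₁ a b d else w₂ a b d with hw₀
    have hprod : NondegenerateOn {k ∈ Icc i j | c k} {k ∈ Icc i j | ¬ c k} fun A =>
        razYehudayoffRec (zeroOne K A) w₁ i k * razYehudayoffRec (zeroOne K A) w₂ (k + 1) j := by
      rw [hsplit, filter_union, filter_union]
      refine hw₁.mul hw₂ (disjoint_filter_filter hdisj) fun A₁ hA₁ A₂ hA₂ B₁ hB₁ B₂ hB₂ => ?_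
      have key : ∀ l, (l ∈ A₁ ∪ B₁ → l ≤ k) ∧ (l ∈ A₂ ∪ B₂ → k < l) := by
        intro l
        constructor
        · intro hl
          rcases mem_union.1 hl with hl | hl
          · exact (mem_Icc.1 (mem_filter.1 (hA₁ hl)).1).2
          · exact (mem_Icc.1 (mem_filter.1 (hB₁ hl)).1).2
        · intro hl
          rcases mem_union.1 hl with hl | hl
          · exact (mem_Icc.1 (mem_filter.1 (hA₂ hl)).1).1
          · exact (mem_Icc.1 (mem_filter.1 (hB₂ hl)).1).1
      rw [union_union_union_comm]
      congr 1
      · refine razYehudayoffRec_zeroOne_congr (fun l h1 h2 => ?_) fun _ _ _ _ _ _ _ => rfl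
        rw [mem_union]
        have := (key l).2
        constructor
        · rintro (h | h)
          · exact h
          · exact absurd (this h) (by omega)
        · exact Or.inl
      · refine razYehudayoffRec_zeroOne_congr (fun l h1 h2 => ?_) fun _ _ _ _ _ _ _ => rfl
        rw [mem_union]
        have := (key l).1
        constructor
        · rintro (h | h)
          · exact absurd (this h) (by omega)
          · exact h
        · exact Or.inr
    obtain ⟨t, ht⟩ := hprod.exists_smul_add hbal fun A =>
      (1 + zeroOne K A i * zeroOne K A j) * razYehudayoffRec (zeroOne K A) (w₀ 0) (i + 1) (j - 1)
    refine ⟨w₀ t, ?_⟩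
    convert ht using 2 with A
    -- A balanced interval has even length, so `k` does occur in the recursion.
    have hkm : k ∈ (Icc (i + 1) (j - 2)).filter fun k => Even (k + 1 - i) := by
      simp only [mem_filter, mem_Icc]
      refine ⟨by omega, ?_⟩
      have h1 := card_filter_add_card_filter_not (s := Icc i k) c
      rw [Nat.card_Icc] at h1
      exact ⟨_, by rw [← h1, ← hk]⟩
    rw [razYehudayoffRec_of_le _ _ h, sum_eq_single k, add_comm]
    · congr 1
      · rw [mul_assoc]
        congr 1
        · simp [hw₀]
        · congr 1
          · refine razYehudayoffRec_congr (fun _ _ _ => rfl) fun a b d h1 h2 h3 h4 => ?_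
            simp only [hw₀]
            rw [if_neg (by omega), if_pos (by omega)]
          · refine razYehudayoffRec_congr (fun _ _ _ => rfl) fun a b d h1 h2 h3 h4 => ?_
            simp only [hw₀]
            rw [if_neg (by omega), if_neg (by omega)]
      · congr 1
        refine razYehudayoffRec_congr (fun _ _ _ => rfl) fun a b d h1 h2 h3 h4 => ?_
        simp only [hw₀]
        rw [if_neg (by omega), if_neg (by omega : ¬ (a = i ∧ d = j))]
    · intro l _ hl
      simp [hw₀, hl]
    · exact fun h => absurd hkm h
  · have hbal' : #{k ∈ Icc (i + 1) (j - 1) | c k} = #{k ∈ Icc (i + 1) (j - 1) | ¬ c k} := by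
      rw [hIcc] at hbal
      by_cases h1 : c i
      · have h2 : ¬ c j := fun h2 => hc (by simp [h1, h2])
        simpa [filter_insert, h1, h2, hlt.ne, hj'] using hbal
      · have h2 : c j := by
          by_contra h2
          exact hc (by simp [h1, h2])
        simpa [filter_insert, h1, h2, hlt.ne, hj'] using hbal
    obtain ⟨w₁, hw₁⟩ := ih _ (by omega) (i + 1) (j - 1) (by omega) hbal' rfl
    -- Zero weights at `a = i` remove the whole sum and do not affect `[i+1,j-1]`.
    set w₀ : ℕ → ℕ → ℕ → K := fun a b d => if a = i then 0 else w₁ a b d with hw₀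
    refine ⟨w₀, ?_⟩
    have hrec : ∀ A, razYehudayoffRec (zeroOne K A) w₀ i j =
        (1 + zeroOne K A i * zeroOne K A j) *
          razYehudayoffRec (zeroOne K A) w₁ (i + 1) (j - 1) := by
      intro A
      rw [razYehudayoffRec_of_le _ _ h, sum_eq_zero, add_zero]
      · congr 1
        refine razYehudayoffRec_congr (fun _ _ _ => rfl) fun a b d h1 h2 h3 h4 => ?_
        simp only [hw₀]
        rw [if_neg (by omega)]
      · intro l _
        simp [hw₀]
    -- the two end points have different colours `p` and `q`
    have hmul : ∀ p q : ℕ, (p = i ∧ q = j ∨ p = j ∧ q = i) →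
        NondegenerateOn ({p} ∪ {k ∈ Icc (i + 1) (j - 1) | c k})
          ({q} ∪ {k ∈ Icc (i + 1) (j - 1) | ¬ c k})
          fun A => razYehudayoffRec (zeroOne K A) w₀ i j := by
      intro p q hpq
      refine (nondegenerateOn_one_add_mul (K := K) (i := p) (j := q) (by omega)).mul hw₁ ?_ ?_
      · rw [disjoint_singleton_left]
        simp only [mem_filter, mem_Icc]
        omega
      · intro A₁ hA₁ A₂ hA₂ B₁ hB₁ B₂ hB₂
        have key1 : ∀ l ∈ A₁ ∪ B₁, l = i ∨ l = j := by
          intro l hl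
          rcases mem_union.1 hl with hl | hl
          · have := mem_singleton.1 (hA₁ hl)
            omega
          · have := mem_singleton.1 (hB₁ hl)
            omega
        have key2 : ∀ l ∈ A₂ ∪ B₂, i < l ∧ l < j := by
          intro l hl
          rcases mem_union.1 hl with hl | hl
          · have := mem_Icc.1 (mem_filter.1 (hA₂ hl)).1
            omega
          · have := mem_Icc.1 (mem_filter.1 (hB₂ hl)).1
            omega
        have key3 : ∀ l, (l = i ∨ l = j) →
            zeroOne K (A₁ ∪ B₁ ∪ (A₂ ∪ B₂)) l = zeroOne K (A₁ ∪ B₁) l := by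
          intro l hl
          have : l ∉ A₂ ∪ B₂ := fun h => by have := key2 l h; omega
          simp only [zeroOne, mem_union (s := A₁ ∪ B₁), this, or_false]
        rw [union_union_union_comm, hrec]
        congr 1
        · rcases hpq with ⟨rfl, rfl⟩ | ⟨rfl, rfl⟩
          · rw [key3 _ (Or.inl rfl), key3 _ (Or.inr rfl)]
          · rw [key3 _ (Or.inl rfl), key3 _ (Or.inr rfl), mul_comm]
        · refine razYehudayoffRec_zeroOne_congr (fun l h1 h2 => ?_) fun _ _ _ _ _ _ _ => rfl
          have : l ∉ A₁ ∪ B₁ := fun h => by have := key1 l h; omega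
          simp only [mem_union (s := A₁ ∪ B₁), this, false_or]
    rw [hIcc]
    by_cases h1 : c i
    · have h2 : ¬ c j := fun h2 => hc (by simp [h1, h2])
      have := hmul i j (Or.inl ⟨rfl, rfl⟩)
      simp only [filter_insert, h1, h2, if_true, if_false, not_true, not_false_eq_true]
      exact this
    · have h2 : c j := by
        by_contra h2
        exact hc (by simp [h1, h2])
      have := hmul j i (Or.inr ⟨rfl, rfl⟩)
      simp only [filter_insert, h1, h2, if_true, if_false, not_true, not_false_eq_true]
      exact this

/-- The matrix factors through `K^T`; triviality of its kernel makes the right factor injective. -/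
theorem NondegenerateOn.le_of_hasSplitRank {α K : Type*} [DecidableEq α] [Field K]
    {Y Z : Finset α} (hYZ : Disjoint Y Z) {h : Finset α → K} (hh : NondegenerateOn Y Z h) {T : ℕ}
    (hT : HasSplitRank Y T h) : 2 ^ #Z ≤ T := by
  obtain ⟨a, b, hab⟩ := hT
  let f : (Z.powerset → K) →ₗ[K] (Fin T → K) :=
    { toFun := fun u t => ∑ B : Z.powerset, b t B * u B
      map_add' := fun u v => by
        ext t
        simp [mul_add, sum_add_distrib]
      map_smul' := fun r u => by
        ext t
        simp only [Pi.smul_apply, smul_eq_mul, RingHom.id_apply, mul_sum]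
        exact sum_congr rfl fun B _ => by ring }
  have hinj : Function.Injective f := by
    rw [injective_iff_map_eq_zero]
    intro u hu
    ext B
    have key := hh (fun B => if hB : B ∈ Z.powerset then u ⟨B, hB⟩ else 0) ?_ B
      (mem_powerset.1 B.2)
    · rwa [dif_pos B.2] at key
    · intro A hA
      rw [← sum_coe_sort]
      have h1 : ∀ B : Z.powerset, h (A ∪ B) = ∑ t, a t A * b t B := by
        intro B
        have hB := mem_powerset.1 B.2
        have e1 : (A ∪ B) ∩ Y = A := by
          rw [union_inter_distrib_right, inter_eq_left.2 hA,
            disjoint_iff_inter_eq_empty.1 (hYZ.symm.mono_left hB), union_empty]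
        have e2 : (A ∪ B) \ Y = B := by
          rw [union_sdiff_distrib, sdiff_eq_empty_iff_subset.2 hA, empty_union,
            sdiff_eq_self_of_disjoint (hYZ.symm.mono_left hB)]
        rw [hab, e1, e2]
      calc ∑ B : Z.powerset, h (A ∪ B) *
            (if hB : (B : Finset α) ∈ Z.powerset then u ⟨B, hB⟩ else 0)
          = ∑ B : Z.powerset, ∑ t, a t A * (b t B * u B) := by
            refine sum_congr rfl fun B _ => ?_
            rw [dif_pos B.2, h1, sum_mul]
            exact sum_congr rfl fun t _ => by ring
        _ = ∑ t, a t A * f u t := by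
            rw [sum_comm]
            exact sum_congr rfl fun t _ => by rw [← mul_sum]; rfl
        _ = 0 := by simp [hu]
  simpa using LinearMap.finrank_le_finrank_of_injective hinj

/-- The shift `k ↦ k + 1`, from the indices of `MvPolynomial (Fin N)` to those of `x_1, …, x_N`. -/
def finSuccEmb (N : ℕ) : Fin N ↪ ℕ :=
  ⟨fun k => k + 1, fun a b h => Fin.ext (by simpa using h)⟩

theorem finSuccEmb_apply {N : ℕ} (k : Fin N) : finSuccEmb N k = k + 1 := rfl

theorem map_finSuccEmb (N : ℕ) (S : Finset (Fin N)) :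
    S.map (finSuccEmb N) = {k ∈ Icc 1 N | k ∈ S.map (finSuccEmb N)} := by
  ext k
  simp only [mem_map, mem_filter, mem_Icc, finSuccEmb_apply]
  constructor
  · rintro ⟨a, ha, rfl⟩
    exact ⟨by omega, a, ha, rfl⟩
  · exact fun h => h.2

theorem map_finSuccEmb_compl (N : ℕ) (S : Finset (Fin N)) :
    Sᶜ.map (finSuccEmb N) = {k ∈ Icc 1 N | k ∉ S.map (finSuccEmb N)} := by
  ext k
  simp only [mem_map, mem_filter, mem_Icc, finSuccEmb_apply, mem_compl]
  constructor
  · rintro ⟨a, ha, rfl⟩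
    refine ⟨by omega, ?_⟩
    rintro ⟨b, hb, h⟩
    exact ha (by rwa [show a = b from Fin.ext (by omega)])
  · rintro ⟨h1, h2⟩
    exact ⟨⟨k - 1, by omega⟩, fun h => h2 ⟨_, h, Nat.sub_add_cancel h1.1⟩,
      Nat.sub_add_cancel h1.1⟩

/-- The weights `w_{i,k,j}` as elements of `F[W]`. -/
noncomputable def ryWeight (F : Type*) [Field F] (N i k j : ℕ) :
    MvPolynomial (Fin N × Fin N × Fin N) F :=
  if h : (1 ≤ i ∧ i ≤ N) ∧ (1 ≤ k ∧ k ≤ N) ∧ (1 ≤ j ∧ j ≤ N) then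
    MvPolynomial.X (⟨i - 1, by omega⟩, ⟨k - 1, by omega⟩, ⟨j - 1, by omega⟩)
  else 0

theorem eval_razYehudayoff (F : Type*) [Field F] (N : ℕ) (A : Finset ℕ) :
    MvPolynomial.eval (zeroOne (RYField F N) {k : Fin N | finSuccEmb N k ∈ A})
        (razYehudayoff F N) =
      algebraMap (MvPolynomial (Fin N × Fin N × Fin N) F) (RYField F N)
        (razYehudayoffRec (zeroOne _ A) (ryWeight F N) 1 N) := by
  rw [razYehudayoff, map_razYehudayoffRec, map_razYehudayoffRec]
  refine razYehudayoffRec_congr (fun k h1 h2 => ?_) fun a b c h1 h2 h3 h4 => ?_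
  · rw [ryX, dif_pos ⟨h1, h2⟩, MvPolynomial.eval_X]
    have hk : (⟨k - 1, by omega⟩ : Fin N) ∈ ({k : Fin N | finSuccEmb N k ∈ A} : Finset _) ↔
        k ∈ A := by
      rw [mem_filter, finSuccEmb_apply]
      simp [Nat.sub_add_cancel h1]
    simp only [zeroOne, hk]
    split_ifs <;> simp
  · rw [ryW, ryWeight, dif_pos (by omega), dif_pos (by omega), MvPolynomial.eval_C]

/-- Nondegeneracy lifts from a specialization in the algebraic closure (infinite even for finite
`F`) to `F[W]`, and passes to `F(W)` by injectivity. -/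
theorem two_pow_le_of_hasSplitRank_razYehudayoff (F : Type*) [Field F] {N : ℕ}
    {S : Finset (Fin N)} (hS : 2 * #S = N) {T : ℕ}
    (hT : HasSplitRank S T fun A =>
      MvPolynomial.eval (zeroOne (RYField F N) A) (razYehudayoff F N)) : 2 ^ #S ≤ T := by
  have hcompl : #Sᶜ = #S := by
    rw [card_compl, Fintype.card_fin]
    omega
  set Y := S.map (finSuccEmb N) with hY
  set Z := Sᶜ.map (finSuccEmb N) with hZ
  have hYZ : #Y = #Z := by rw [hY, hZ, card_map, card_map, hcompl]
  have hdisj : Disjoint Y Z := (disjoint_map _).2 disjoint_compl_right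
  obtain ⟨w, hw⟩ := exists_nondegenerateOn_razYehudayoffRec (K := AlgebraicClosure F)
    (fun k => k ∈ Y) 1 N le_rfl (by rw [← map_finSuccEmb, ← map_finSuccEmb_compl]; exact hYZ)
  rw [← map_finSuccEmb, ← map_finSuccEmb_compl] at hw
  let ψ : MvPolynomial (Fin N × Fin N × Fin N) F →+* AlgebraicClosure F :=
    (MvPolynomial.aeval fun p => w (p.1 + 1) (p.2.1 + 1) (p.2.2 + 1)).toRingHom
  have hψ : NondegenerateOn Y Z fun A =>
      ψ (razYehudayoffRec (zeroOne _ A) (ryWeight F N) 1 N) := by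
    convert hw using 2 with A
    rw [map_razYehudayoffRec]
    refine razYehudayoffRec_congr (fun k h1 h2 => ?_) fun a b c h1 h2 h3 h4 => ?_
    · simp only [zeroOne]
      split_ifs <;> simp
    · rw [ryWeight, dif_pos (by omega)]
      simp only [ψ, AlgHom.toRingHom_eq_coe, RingHom.coe_coe, MvPolynomial.aeval_X]
      rw [Nat.sub_add_cancel (by omega), Nat.sub_add_cancel (by omega),
        Nat.sub_add_cancel (by omega)]
  have hG := (hψ.of_map hYZ).map hYZ (FaithfulSMul.algebraMap_injective
    (MvPolynomial (Fin N × Fin N × Fin N) F) (RYField F N))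
  rw [← hcompl, ← card_map (finSuccEmb N)]
  refine hG.le_of_hasSplitRank hdisj ?_
  obtain ⟨a, b, hab⟩ := hT
  refine ⟨fun t A => a t {k : Fin N | finSuccEmb N k ∈ A},
    fun t A => b t {k : Fin N | finSuccEmb N k ∈ A}, fun A => ?_⟩
  beta_reduce at hab ⊢
  rw [← eval_razYehudayoff, hab]
  refine sum_congr rfl fun t _ => ?_
  congr 2
  · ext k
    simp [hY]
  · ext k
    simp [hY]

end RazYehudayoff

/-! ### Split rank of read-once programs. -/

section ReadOnce

open Finset

/-- The product `T a * T (a + 1) * ⋯ * T (a + n - 1)`. -/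
def segProd {M : Type*} [Monoid M] (T : ℕ → M) (a : ℕ) : ℕ → M
  | 0 => 1
  | n + 1 => segProd T a n * T (a + n)

theorem segProd_add {M : Type*} [Monoid M] (T : ℕ → M) (a m n : ℕ) :
    segProd T a (m + n) = segProd T a m * segProd T (a + m) n := by
  induction n with
  | zero => simp [segProd]
  | succ n ih => rw [← add_assoc, segProd, ih, segProd, mul_assoc, add_assoc]

theorem segProd_congr {M : Type*} [Monoid M] {T T' : ℕ → M} {a n : ℕ}
    (h : ∀ i, a ≤ i → i < a + n → T i = T' i) : segProd T a n = segProd T' a n := by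
  induction n with
  | zero => rfl
  | succ n ih =>
    rw [segProd, segProd, ih fun i h1 h2 => h i h1 (by omega), h _ (by omega) (by omega)]

/-- Summing over the node at each block boundary leaves products of functions that each depend on a
single block. -/
theorem hasSplitRank_segProd {α V K : Type*} [DecidableEq α] [Fintype V] [DecidableEq V]
    [CommSemiring K] (T : Finset α → ℕ → Matrix V V K) {ℓ : ℕ → ℕ} (hℓ : Monotone ℓ)
    (hℓ0 : ℓ 0 = 0) (B : ℕ → Finset α) (S : Finset α) (q : ℕ)
    (hB : ∀ j < q, ∀ i, ℓ j ≤ i → i < ℓ (j + 1) → ∀ A, T A i = T (A ∩ B j) i) (u v : V) :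
    HasSplitRank S (Fintype.card V ^ q * ∏ j ∈ range q, 2 ^ min #(B j ∩ S) #(B j \ S))
      fun A => segProd (T A) 0 (ℓ q) u v := by
  induction q generalizing v with
  | zero => simpa [hℓ0, segProd] using HasSplitRank.const _
  | succ q ih =>
    have hle := hℓ q.le_succ
    have key : ∀ A, segProd (T A) 0 (ℓ (q + 1)) u v =
        ∑ k, segProd (T A) 0 (ℓ q) u k * segProd (T A) (ℓ q) (ℓ (q + 1) - ℓ q) k v := by
      intro A
      have h := segProd_add (T A) 0 (ℓ q) (ℓ (q + 1) - ℓ q)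
      rw [Nat.add_sub_cancel' hle, zero_add] at h
      rw [h, Matrix.mul_apply]
    simp only [key]
    have h2 := fun k => (ih (fun j hj => hB j (hj.trans q.lt_succ_self)) k).mul
      (HasSplitRank.of_dependsOn (S := S) (B := B q)
        (h := fun A => segProd (T A) (ℓ q) (ℓ (q + 1) - ℓ q) k v) fun A => by
          rw [segProd_congr (T := T A) (T' := T (A ∩ B q)) fun i h1 h2 =>
            hB q q.lt_succ_self i h1 (by omega) A])
    refine (HasSplitRank.sum_const h2).mono (le_of_eq ?_)
    rw [pow_succ, prod_range_succ]
    ring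

/-- The blocks of size `b` of the order `σ`; the last block, number `q`, is what remains. -/
def orderBlock {N : ℕ} (σ : Equiv.Perm (Fin N)) (b q j : ℕ) : Finset (Fin N) :=
  {x | min q ((σ.symm x : ℕ) / b) = j}

theorem orderBlock_disjoint {N : ℕ} (σ : Equiv.Perm (Fin N)) (b q : ℕ) {i j : ℕ} (h : i ≠ j) :
    Disjoint (orderBlock σ b q i) (orderBlock σ b q j) := by
  rw [disjoint_left]
  intro x
  simp only [orderBlock, mem_filter, mem_univ, true_and]
  omega

theorem card_orderBlock {N : ℕ} (σ : Equiv.Perm (Fin N)) {b q j : ℕ} (hb : 0 < b)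
    (hN : q * b ≤ N) (hj : j < q) : #(orderBlock σ b q j) = b := by
  have h1 : ∀ i : Fin b, j * b + i < N := by
    intro i
    have h2 : (j + 1) * b ≤ q * b := Nat.mul_le_mul_right _ hj
    have := i.2
    rw [add_mul, one_mul] at h2
    omega
  let f : Fin b ↪ Fin N := ⟨fun i => σ ⟨j * b + i, h1 i⟩, fun i i' h => by
    have := congrArg Fin.val (σ.injective h)
    exact Fin.ext (by simpa using this)⟩
  have hf : ∀ i, f i = σ ⟨j * b + i, h1 i⟩ := fun _ => rfl
  have : orderBlock σ b q j = univ.map f := by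
    ext x
    simp only [orderBlock, mem_filter, mem_univ, true_and, mem_map, hf]
    constructor
    · intro hx
      have hx' : (σ.symm x : ℕ) / b = j := by omega
      have h3 := Nat.div_add_mod (σ.symm x : ℕ) b
      rw [hx', mul_comm] at h3
      exact ⟨⟨_, Nat.mod_lt _ hb⟩, σ.eq_symm_apply.1 (Fin.ext h3)⟩
    · rintro ⟨i, rfl⟩
      rw [Equiv.symm_apply_apply]
      simp only
      rw [mul_comm, Nat.mul_add_div hb, Nat.div_eq_of_lt i.2]
      omega
  rw [this, card_map, card_univ, Fintype.card_fin]

theorem card_orderBlock_last {N : ℕ} (σ : Equiv.Perm (Fin N)) {b q : ℕ} (hb : 0 < b)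
    (hN : q * b ≤ N) : #(orderBlock σ b q q) + q * b = N := by
  have h := card_eq_sum_card_fiberwise (s := (univ : Finset (Fin N))) (t := range (q + 1))
    (f := fun x => min q ((σ.symm x : ℕ) / b)) (fun x _ => by simp)
  rw [card_univ, Fintype.card_fin, sum_range_succ] at h
  have h2 : ∑ j ∈ range q, #{x : Fin N | min q ((σ.symm x : ℕ) / b) = j} = q * b := by
    refine (sum_congr rfl fun j hj => card_orderBlock σ hb hN (mem_range.1 hj)).trans ?_
    simp
  rw [h2] at h
  conv_rhs => rw [h]
  rw [add_comm]
  rfl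

/-- The split rank of a read-once oblivious branching program: the layer `i` depends only on the
variable `x` with `lay x = i`. -/
theorem hasSplitRank_readOnce {N : ℕ} {V K : Type*} [Fintype V] [DecidableEq V] [CommSemiring K]
    (T : Finset (Fin N) → ℕ → Matrix V V K) (len : ℕ) (lay : Fin N → ℕ)
    (hinj : ∀ x y, lay x = lay y → lay x < len → x = y)
    (hT : ∀ i < len, ∀ A A', (∀ x, lay x = i → (x ∈ A ↔ x ∈ A')) → T A i = T A' i)
    {b q : ℕ} (hb : 0 < b) (u v : V) (S : Finset (Fin N)) :
    HasSplitRank S (Fintype.card V ^ (q + 1) * ∏ j ∈ range (q + 1),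
        2 ^ min #(orderBlock (Tuple.sort lay) b q j ∩ S) #(orderBlock (Tuple.sort lay) b q j \ S))
      fun A => segProd (T A) 0 len u v := by
  set σ := Tuple.sort lay with hσ
  have hmono : ∀ i j : Fin N, i ≤ j → lay (σ i) ≤ lay (σ j) := fun i j h => Tuple.monotone_sort lay h
  -- `ℓ j` is the layer of variable number `j * b` in the sorted order, so the layers from `ℓ j` up
  -- to `ℓ (j + 1)` read only block `j`. Capping at `len` handles variables that are never read.
  set ℓ : ℕ → ℕ := fun j => if j = 0 then 0 else
    if h : j ≤ q ∧ j * b < N then min len (lay (σ ⟨j * b, h.2⟩)) else len with hℓ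
  have hℓlen : ∀ j, ℓ j ≤ len := by
    intro j
    simp only [hℓ]
    split_ifs
    · exact Nat.zero_le _
    · exact min_le_left _ _
    · exact le_rfl
  have hℓmono : Monotone ℓ := by
    refine monotone_nat_of_le_succ fun j => ?_
    by_cases h0 : j = 0
    · simp [hℓ, h0]
    by_cases h1 : j + 1 ≤ q ∧ (j + 1) * b < N
    · have h2 : j * b ≤ (j + 1) * b := Nat.mul_le_mul_right _ j.le_succ
      have h3 : j ≤ q ∧ j * b < N := ⟨by omega, by omega⟩
      simp only [hℓ]
      rw [if_neg h0, if_neg j.succ_ne_zero, dif_pos h3, dif_pos h1]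
      exact min_le_min_left _ (hmono _ _ h2)
    · refine (hℓlen j).trans (le_of_eq ?_)
      simp only [hℓ]
      rw [if_neg j.succ_ne_zero, dif_neg h1]
  have hlast : ℓ (q + 1) = len := by
    simp only [hℓ]
    rw [if_neg q.succ_ne_zero, dif_neg (by omega)]
  rw [← hlast]
  refine hasSplitRank_segProd T hℓmono (by simp [hℓ]) (orderBlock σ b q) S (q + 1) ?_ u v
  intro j hj i h1 h2 A
  have hi : i < len := h2.trans_le (hℓlen _)
  refine hT i hi _ _ fun x hx => ?_
  have hxj : x ∈ orderBlock σ b q j := by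
    set k := σ.symm x with hk
    have hkx : σ k = x := by rw [hk, Equiv.apply_symm_apply]
    have hlow : j * b ≤ k := by
      by_contra hlt
      have hj0 : j ≠ 0 := by
        rintro rfl
        omega
      by_cases h3 : j ≤ q ∧ j * b < N
      · have h4 : ℓ j = min len (lay (σ ⟨j * b, h3.2⟩)) := by
          simp only [hℓ]
          rw [if_neg hj0, dif_pos h3]
        have h5 := hmono k ⟨j * b, h3.2⟩ (by rw [Fin.le_def]; simp; omega)
        rw [hkx] at h5
        have h6 : lay x = lay (σ ⟨j * b, h3.2⟩) := by omega
        have h7 := hinj _ _ h6 (by omega)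
        rw [← hkx] at h7
        have h8 := congrArg Fin.val (σ.injective h7)
        simp only at h8
        omega
      · have h4 : ℓ j = len := by
          simp only [hℓ]
          rw [if_neg hj0, dif_neg h3]
        omega
    have hup : j < q → (k : ℕ) < (j + 1) * b := by
      intro hjq
      by_cases h3 : (j + 1) * b < N
      · have h4 : ℓ (j + 1) = min len (lay (σ ⟨(j + 1) * b, h3⟩)) := by
          simp only [hℓ]
          rw [if_neg j.succ_ne_zero, dif_pos ⟨hjq, h3⟩]
        by_contra hge
        have h5 := hmono ⟨(j + 1) * b, h3⟩ k (by rw [Fin.le_def]; simp; omega)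
        rw [hkx] at h5
        omega
      · have := k.2
        omega
    simp only [orderBlock, mem_filter, mem_univ, true_and]
    change min q ((k : ℕ) / b) = j
    have h3 : j ≤ (k : ℕ) / b := (Nat.le_div_iff_mul_le hb).2 hlow
    by_cases hjq : j < q
    · have h4 : (k : ℕ) / b < j + 1 := (Nat.div_lt_iff_lt_mul hb).2 (hup hjq)
      omega
    · omega
  simp [hxj]

end ReadOnce

/-! ### From `r` passes to sums of read-once programs. -/

section Passes

open Finset

/-- Cutting a concatenation of `Ls.length` sequences without repetitions, after every one of them,
separates any two occurrences of the same element. -/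
theorem exists_cuts_of_sublist_flatten {σ : Type*} (Ls : List (List σ)) (hLs : ∀ L ∈ Ls, L.Nodup)
    (l : List (Option σ)) (hl : l.reduceOption.Sublist Ls.flatten) :
    ∃ cut : ℕ → ℕ, ∀ (i i' : ℕ) (x : σ), i < i' → l[i]? = some (some x) →
      l[i']? = some (some x) → ∃ a < Ls.length, i < cut a ∧ cut a ≤ i' := by
  induction Ls generalizing l with
  | nil =>
    refine ⟨0, fun i i' x _ hi _ => ?_⟩
    have h1 : x ∈ l.reduceOption := List.reduceOption_mem_iff.2 (List.mem_of_getElem? hi)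
    rw [List.flatten_nil, List.sublist_nil] at hl
    simp [hl] at h1
  | cons L Ls ih =>
    rw [List.flatten_cons, List.sublist_append_iff] at hl
    obtain ⟨l₁, l₂, hl, h1, h2⟩ := hl
    obtain ⟨m₁, m₂, rfl, rfl, rfl⟩ := List.filterMap_eq_append_iff.1 hl
    obtain ⟨cut, hcut⟩ := ih (fun L hL => hLs L (by simp [hL])) m₂ h2
    -- The first cut ends the first pass, which reads nothing twice; the others are the cuts of the
    -- rest, shifted.
    refine ⟨fun a => a.casesOn m₁.length fun a => m₁.length + cut a, fun i i' x hii hi hi' => ?_⟩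
    rcases lt_or_ge i' m₁.length with h | h
    · exfalso
      rw [List.getElem?_append_left (by omega)] at hi hi'
      have hnd : (List.filterMap id m₁).Nodup := (hLs L (by simp)).sublist h1
      rw [List.Nodup, List.pairwise_filterMap] at hnd
      have h3 := List.pairwise_iff_getElem.1 hnd i i' (by omega) h hii x
        (by simpa using (List.getElem?_eq_some_iff.1 hi).2) x
        (by simpa using (List.getElem?_eq_some_iff.1 hi').2)
      exact h3 rfl
    · rcases lt_or_ge i m₁.length with h' | h'
      · exact ⟨0, by simp, h', h⟩
      · rw [List.getElem?_append_right (by omega)] at hi hi'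
        obtain ⟨a, ha, h3, h4⟩ := hcut _ _ x (by omega) hi hi'
        exact ⟨a + 1, by simpa using ha, by simp only; omega, by simp only; omega⟩

/-- The entries of a product of matrices are sums over paths. -/
theorem segProd_apply_eq_sum {V K : Type*} [Fintype V] [DecidableEq V] [CommSemiring K]
    (T : ℕ → Matrix V V K) (n : ℕ) (s t : V) :
    segProd T 0 n s t = ∑ u : Fin (n + 1) → V,
      if u 0 = s ∧ u (Fin.last n) = t then ∏ i : Fin n, T i (u i.castSucc) (u i.succ) else 0 := by
  induction n generalizing t with
  | zero =>
    rw [← (Equiv.funUnique (Fin 1) V).symm.sum_comp]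
    simp only [segProd, Matrix.one_apply, Finset.univ_eq_empty, Finset.prod_empty]
    by_cases hst : s = t
    · subst hst
      simp [Equiv.funUnique]
    · rw [if_neg hst, sum_eq_zero]
      intro v _
      rw [if_neg]
      rintro ⟨h1, h2⟩
      exact hst (h1.symm.trans h2)
  | succ n ih =>
    rw [segProd, Matrix.mul_apply, ← (Fin.snocEquiv fun _ => V).sum_comp, Fintype.sum_prod_type]
    conv_rhs => rw [Finset.sum_eq_single t (fun v _ hv => sum_eq_zero fun u _ => if_neg (by
      simp [Fin.snocEquiv, hv])) (by simp)]
    simp only [ih, Finset.sum_mul]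
    rw [sum_comm]
    refine sum_congr rfl fun u _ => ?_
    rw [sum_eq_single (u (Fin.last n))]
    · simp only [Fin.snocEquiv, Equiv.coe_fn_mk, Fin.snoc_last, and_true, zero_add]
      have h0 : (Fin.snoc u t : Fin (n + 2) → V) 0 = u 0 := by
        rw [← Fin.castSucc_zero, Fin.snoc_castSucc]
      rw [h0, ite_mul, zero_mul, Fin.prod_univ_castSucc]
      refine if_congr Iff.rfl ?_ rfl
      congr 1
      · refine prod_congr rfl fun i _ => ?_
        rw [Fin.snoc_castSucc, ← Fin.castSucc_succ, Fin.snoc_castSucc]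
        rfl
      · rw [Fin.snoc_castSucc, Fin.succ_last, Fin.snoc_last]
        rfl
    · intro v _ hv
      rw [if_neg fun h => hv h.2.symm, zero_mul]
    · simp

namespace ABP

variable {σ K : Type*}

open Classical in
/-- The sum over all paths of the products of weights of the edges, as a matrix product. -/
theorem sum_isPath_eq_segProd [CommSemiring K] (P : ABP σ K) (c : ℕ → Fin P.numEdges → K) :
    ∑ p : (Fin (P.len + 1) → Fin P.size) × (Fin P.len → Fin P.numEdges) with P.IsPath p.1 p.2,
      ∏ i : Fin P.len, c i (p.2 i) =
    segProd (fun i => Matrix.of fun a b => ∑ e with P.src e = a ∧ P.tgt e = b, c i e) 0 P.len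
      P.start P.term := by
  rw [segProd_apply_eq_sum, sum_filter, Fintype.sum_prod_type]
  refine sum_congr rfl fun u _ => ?_
  by_cases hu : u 0 = P.start ∧ u (Fin.last P.len) = P.term
  · rw [if_pos hu]
    simp only [Matrix.of_apply]
    rw [prod_univ_sum, ← sum_filter]
    refine sum_congr ?_ fun _ _ => rfl
    ext e
    simp [IsPath, hu]
  · rw [if_neg hu]
    exact sum_eq_zero fun e _ => if_neg fun h => hu ⟨h.1, h.2.1⟩

/-- The value of the label of an edge at a zero-one point. -/
def edgeVal [DecidableEq σ] [Field K] (P : ABP σ K) (A : Finset σ) (e : Fin P.numEdges) : K :=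
  Sum.elim (zeroOne K A) id (P.label e)

open Classical in
theorem eval_poly [DecidableEq σ] [Field K] (P : ABP σ K) (A : Finset σ) :
    MvPolynomial.eval (zeroOne K A) P.poly =
      ∑ p : (Fin (P.len + 1) → Fin P.size) × (Fin P.len → Fin P.numEdges) with P.IsPath p.1 p.2,
        ∏ i, P.edgeVal A (p.2 i) := by
  rw [poly, map_sum]
  refine sum_congr rfl fun p _ => ?_
  rw [map_prod]
  refine prod_congr rfl fun i _ => ?_
  rw [edgePoly, edgeVal]
  cases P.label (p.2 i) <;> simp

theorem IsPath.layer_eq {P : ABP σ K} {u : Fin (P.len + 1) → Fin P.size}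
    {e : Fin P.len → Fin P.numEdges} (h : P.IsPath u e) (i : Fin (P.len + 1)) :
    P.layer (u i) = i := by
  induction i using Fin.induction with
  | zero => rw [h.1, P.layer_start]
  | succ i ih =>
    ext
    rw [← (h.2.2 i).2, P.layer_tgt, (h.2.2 i).1, ih]
    simp

/-- Following one path up to a common node, and another one from there on. -/
theorem IsPath.splice {P : ABP σ K} {u u' : Fin (P.len + 1) → Fin P.size}
    {e e' : Fin P.len → Fin P.numEdges} (h : P.IsPath u e) (h' : P.IsPath u' e') {c : ℕ}
    (hc : ∀ i : Fin (P.len + 1), (i : ℕ) = c → u i = u' i) (hlen : c ≤ P.len) :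
    P.IsPath (fun i => if (i : ℕ) < c then u i else u' i)
      (fun i => if (i : ℕ) < c then e i else e' i) := by
  refine ⟨?_, ?_, fun i => ?_⟩
  · by_cases h0 : 0 < c
    · simpa [h0] using h.1
    · simpa [h0] using h'.1
  · simpa [hlen.not_gt] using h'.2.1
  · simp only [Fin.val_castSucc, Fin.val_succ]
    rcases lt_trichotomy ((i : ℕ) + 1) c with h1 | h1 | h1
    · rw [if_pos (by omega), if_pos (by omega), if_pos h1]
      exact h.2.2 i
    · rw [if_pos (by omega), if_pos (by omega), if_neg (by omega), ← hc i.succ (by simpa using h1)]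
      exact h.2.2 i
    · rw [if_neg (by omega), if_neg (by omega), if_neg (by omega)]
      exact h'.2.2 i

theorem IsSyntacticMultilinear.false_of_splice {P : ABP σ K} (hP : P.IsSyntacticMultilinear)
    {u u' : Fin (P.len + 1) → Fin P.size} {e e' : Fin P.len → Fin P.numEdges}
    (h : P.IsPath u e) (h' : P.IsPath u' e') {c : ℕ}
    (hc : ∀ i : Fin (P.len + 1), (i : ℕ) = c → u i = u' i) {i i' : Fin P.len} (hi : (i : ℕ) < c)
    (hi' : c ≤ i') {x : σ} (hx : P.label (e i) = Sum.inl x) (hx' : P.label (e' i') = Sum.inl x) :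
    False := by
  have := hP _ _ (h.splice h' hc (by omega)) x i i' (by simpa [hi] using hx)
    (by simpa [hi'.not_gt] using hx')
  subst this
  omega

/-- The nodes in the layers `cut 0, …, cut (r - 1)`. -/
def cutNodes (P : ABP σ K) {r : ℕ} (cut : ℕ → ℕ) (u : Fin (P.len + 1) → Fin P.size) (a : Fin r) :
    Fin P.size :=
  -- A cut at or beyond the last layer separates no two edges, so a constant default loses nothing.
  if h : cut a < P.len then u ⟨cut a, by omega⟩ else P.start

/-- The edge `e` is number `i` on some path through the nodes `τ` of the cut layers. -/
def Alive (P : ABP σ K) {r : ℕ} (cut : ℕ → ℕ) (τ : Fin r → Fin P.size) (i : ℕ)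
    (e : Fin P.numEdges) : Prop :=
  ∃ u e', P.IsPath u e' ∧ P.cutNodes cut u = τ ∧ ∃ h : i < P.len, e' ⟨i, h⟩ = e

open Classical in
/-- The part of a multilinear ABP that runs through given nodes in the cut layers is read-once. -/
theorem hasSplitRank_cut [Field K] {N r : ℕ} {P : ABP (Fin N) K} (hml : P.IsSyntacticMultilinear)
    {v : Fin P.len → Option (Fin N)} (hv : P.Reads v) {cut : ℕ → ℕ}
    (hcut : ∀ (i i' : Fin P.len) (x : Fin N), i < i' → v i = some x → v i' = some x →
      ∃ a < r, i < cut a ∧ cut a ≤ i') (τ : Fin r → Fin P.size) {b : ℕ} (hb : 0 < b) (q : ℕ) :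
    ∃ π : Equiv.Perm (Fin N), ∀ S, HasSplitRank S (P.size ^ (q + 1) * ∏ j ∈ range (q + 1),
        2 ^ min #(orderBlock π b q j ∩ S) #(orderBlock π b q j \ S))
      fun A => ∑ p : (Fin (P.len + 1) → Fin P.size) × (Fin P.len → Fin P.numEdges) with
        P.IsPath p.1 p.2 ∧ P.cutNodes cut p.1 = τ, ∏ i, P.edgeVal A (p.2 i) := by
  by_cases hex : ∃ u e, P.IsPath u e ∧ P.cutNodes cut u = τ
  swap
  · refine ⟨1, fun S => ?_⟩
    rw [filter_false_of_mem fun p _ h => hex ⟨p.1, p.2, h⟩]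
    simp only [sum_empty]
    exact (HasSplitRank.const 0).mono (Nat.mul_pos (pow_pos P.start.pos _)
      (prod_pos fun _ _ => by positivity))
  obtain ⟨u₀, e₀, hp₀, hτ₀⟩ := hex
  have hread : ∀ i e x, P.Alive cut τ i e → P.label e = Sum.inl x →
      ∃ h : i < P.len, v ⟨i, h⟩ = some x := by
    rintro i e x ⟨u, e', hp, -, h, rfl⟩ hx
    refine ⟨h, hv _ _ _ ?_ hx⟩
    rw [(hp.2.2 _).1, hp.layer_eq]
  -- Two alive edges reading `x` in different layers are separated by a cut. Their paths share the
  -- node there, so splicing them gives a path that reads `x` twice.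
  have hunique : ∀ i i' e e' x, P.Alive cut τ i e → P.Alive cut τ i' e' →
      P.label e = Sum.inl x → P.label e' = Sum.inl x → ¬ i < i' := by
    intro i i' e e' x h h' hx hx' hlt
    obtain ⟨hi, hvi⟩ := hread i e x h hx
    obtain ⟨hi', hvi'⟩ := hread i' e' x h' hx'
    obtain ⟨a, ha, h1, h2⟩ := hcut ⟨i, hi⟩ ⟨i', hi'⟩ x hlt hvi hvi'
    obtain ⟨u, f, hp, hτ, _, rfl⟩ := h
    obtain ⟨u', f', hp', hτ', _, rfl⟩ := h'
    simp only at h1 h2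
    refine hml.false_of_splice hp hp' (c := cut a) ?_ h1 h2 hx hx'
    intro k hk
    have h3 := congrFun (hτ.trans hτ'.symm) ⟨a, ha⟩
    simp only [cutNodes] at h3
    rw [dif_pos (by omega), dif_pos (by omega)] at h3
    convert h3 using 2 <;> exact Fin.ext hk
  -- The only layer with an alive edge reading `x`; the value `P.len` marks a variable that no alive
  -- edge reads.
  let lay : Fin N → ℕ := fun x =>
    if h : ∃ i e, P.Alive cut τ i e ∧ P.label e = Sum.inl x then h.choose else P.len
  have hlay : ∀ i e x, P.Alive cut τ i e → P.label e = Sum.inl x → lay x = i := by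
    intro i e x he hx
    have h : ∃ i e, P.Alive cut τ i e ∧ P.label e = Sum.inl x := ⟨i, e, he, hx⟩
    simp only [lay]
    rw [dif_pos h]
    obtain ⟨e', he', hx'⟩ := h.choose_spec
    exact le_antisymm (not_lt.1 (hunique _ _ _ _ x he he' hx hx'))
      (not_lt.1 (hunique _ _ _ _ x he' he hx' hx))
  have hlay' : ∀ x, lay x < P.len → ∃ h : lay x < P.len, v ⟨lay x, h⟩ = some x := by
    intro x hx
    by_cases h : ∃ i e, P.Alive cut τ i e ∧ P.label e = Sum.inl x
    · obtain ⟨i, e, he, hx⟩ := h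
      rw [hlay i e x he hx]
      exact hread i e x he hx
    · simp only [lay] at hx
      rw [dif_neg h] at hx
      omega
  -- Discarding the dead edges leaves exactly the paths through `τ`.
  let c : Finset (Fin N) → ℕ → Fin P.numEdges → K := fun A i e =>
    if P.Alive cut τ i e then P.edgeVal A e else 0
  let T : Finset (Fin N) → ℕ → Matrix (Fin P.size) (Fin P.size) K := fun A i =>
    Matrix.of fun a b => ∑ e with P.src e = a ∧ P.tgt e = b, c A i e
  have hsum : ∀ A, ∑ p : (Fin (P.len + 1) → Fin P.size) × (Fin P.len → Fin P.numEdges) with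
      P.IsPath p.1 p.2 ∧ P.cutNodes cut p.1 = τ, ∏ i, P.edgeVal A (p.2 i) =
        segProd (T A) 0 P.len P.start P.term := by
    intro A
    rw [← P.sum_isPath_eq_segProd (c A), ← filter_filter, sum_filter]
    refine sum_congr rfl fun p hp => ?_
    rw [mem_filter] at hp
    split_ifs with h
    · refine prod_congr rfl fun i _ => ?_
      simp only [c]
      rw [if_pos ⟨p.1, p.2, hp.2, h, i.2, rfl⟩]
    · symm
      rw [prod_eq_zero_iff]
      by_contra hne
      push Not at hne
      apply h
      -- The alive edge leaving a cut layer also lies on a path through `τ`, so its source is the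
      -- prescribed node.
      have halive : ∀ i : Fin P.len, P.Alive cut τ i (p.2 i) := by
        intro i
        by_contra hna
        exact hne i (mem_univ i) (if_neg hna)
      ext1 a
      by_cases ha : cut a < P.len
      · obtain ⟨u, f, hp', rfl, _, hf⟩ := halive ⟨cut a, ha⟩
        simp only [cutNodes]
        rw [dif_pos ha, dif_pos ha]
        have h1 := (hp.2.2.2 ⟨cut a, ha⟩).1
        have h2 := (hp'.2.2 ⟨cut a, ha⟩).1
        rw [← hf] at h1
        exact h1.symm.trans h2
      · rw [← hτ₀]
        simp only [cutNodes]
        rw [dif_neg ha, dif_neg ha]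
  refine ⟨Tuple.sort lay, fun S => ?_⟩
  simp only [hsum]
  have := hasSplitRank_readOnce T P.len lay ?_ ?_ hb (q := q) P.start P.term S
  · rwa [Fintype.card_fin] at this
  · intro x y hxy hx
    obtain ⟨h1, h2⟩ := hlay' x hx
    obtain ⟨h3, h4⟩ := hlay' y (hxy ▸ hx)
    have h5 : (⟨lay x, h1⟩ : Fin P.len) = ⟨lay y, h3⟩ := Fin.ext hxy
    rw [h5, h4] at h2
    exact (Option.some.inj h2).symm
  · intro i hi A A' hA
    ext a b
    simp only [T, Matrix.of_apply]
    refine sum_congr rfl fun e _ => ?_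
    simp only [c]
    split_ifs with he
    · simp only [edgeVal]
      rcases hl : P.label e with x | y
      · simp only [Sum.elim_inl, zeroOne, hA x (hlay i e x he hl)]
      · rfl
    · rfl

/-- An `r`-pass multilinear ABP of size `s` is a sum of `s ^ r` read-once ones. -/
theorem IsRPassMultilinear.exists_orders [Field K] {N r : ℕ} {P : ABP (Fin N) K}
    (hP : P.IsRPassMultilinear r) {b : ℕ} (hb : 0 < b) (q : ℕ) :
    ∃ π : (Fin r → Fin P.size) → Equiv.Perm (Fin N), ∀ S, HasSplitRank S
      (∑ τ, P.size ^ (q + 1) * ∏ j ∈ range (q + 1),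
        2 ^ min #(orderBlock (π τ) b q j ∩ S) #(orderBlock (π τ) b q j \ S))
      fun A => MvPolynomial.eval (zeroOne K A) P.poly := by
  classical
  obtain ⟨-, hml, ρ, v, hv, hsub⟩ := hP
  obtain ⟨cut, hcut⟩ := exists_cuts_of_sublist_flatten _ (by
    intro L hL
    obtain ⟨a, rfl⟩ := List.mem_ofFn.1 hL
    exact List.nodup_ofFn.2 (ρ a).injective) _ hsub
  rw [List.length_ofFn] at hcut
  have hcut' : ∀ (i i' : Fin P.len) (x : Fin N), i < i' → v i = some x → v i' = some x →
      ∃ a < r, i < cut a ∧ cut a ≤ i' := by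
    intro i i' x hii hi hi'
    exact hcut i i' x hii (by simp [hi]) (by simp [hi'])
  choose π hπ using fun τ : Fin r → Fin P.size => hasSplitRank_cut hml hv hcut' τ hb q
  refine ⟨π, fun S => ?_⟩
  have hsum : ∀ A, MvPolynomial.eval (zeroOne K A) P.poly = ∑ τ : Fin r → Fin P.size,
      ∑ p : (Fin (P.len + 1) → Fin P.size) × (Fin P.len → Fin P.numEdges) with
        P.IsPath p.1 p.2 ∧ P.cutNodes cut p.1 = τ, ∏ i, P.edgeVal A (p.2 i) := by
    intro A
    rw [eval_poly]
    simp only [← filter_filter]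
    exact (sum_fiberwise _ (fun p : _ × (Fin P.len → Fin P.numEdges) => P.cutNodes cut p.1) _).symm
  simp only [hsum]
  exact HasSplitRank.sum fun τ => hπ τ S

end ABP

end Passes

/-! ### The lower bound and the choice of parameters. -/

section LowerBound

open Finset

/-- Edges join different layers, so a single node admits no edge and the polynomial is constant. -/
theorem ABP.hasSplitRank_one_of_size_le_one {N : ℕ} {K : Type*} [Field K] (P : ABP (Fin N) K)
    (hP : P.size ≤ 1) (S : Finset (Fin N)) :
    HasSplitRank S 1 fun A => MvPolynomial.eval (zeroOne K A) P.poly := by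
  have hE : IsEmpty (Fin P.numEdges) := ⟨fun e => by
    have h := P.layer_tgt e
    rw [show P.tgt e = P.src e from Fin.ext (by omega)] at h
    omega⟩
  have h : ∀ A, MvPolynomial.eval (zeroOne K A) P.poly =
      MvPolynomial.eval (zeroOne K ∅) P.poly := fun A => by
    rw [P.eval_poly, P.eval_poly]
    exact sum_congr rfl fun p _ => prod_congr rfl fun i _ => isEmptyElim (p.2 i)
  simp only [h]
  exact HasSplitRank.const _

/-- In a full block the minimum and the imbalance add up to `a`; in the remainder the minimum is at
most half of its size. -/
theorem sum_min_orderBlock_add_le {n q a D : ℕ} (π : Equiv.Perm (Fin (2 * n))) (ha : 0 < a)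
    (hq : q * (2 * a) ≤ 2 * n) (S : Finset (Fin (2 * n)))
    (hD : D ≤ ∑ j : Fin q, Nat.dist #(S ∩ orderBlock π (2 * a) q j) a) :
    ∑ j ∈ range (q + 1),
      min #(orderBlock π (2 * a) q j ∩ S) #(orderBlock π (2 * a) q j \ S) + D ≤ n := by
  rw [Fin.sum_univ_eq_sum_range (fun j => Nat.dist #(S ∩ orderBlock π (2 * a) q j) a)] at hD
  have h1 : ∑ j ∈ range q, (min #(orderBlock π (2 * a) q j ∩ S) #(orderBlock π (2 * a) q j \ S) +
      Nat.dist #(S ∩ orderBlock π (2 * a) q j) a) = q * a := by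
    refine (sum_congr rfl fun j hj => ?_).trans (sum_const_nat (m := a) fun _ _ => rfl) |>.trans
      (by rw [card_range])
    have h2 := card_orderBlock π (by omega : 0 < 2 * a) hq (mem_range.1 hj)
    have h3 := card_inter_add_card_sdiff (orderBlock π (2 * a) q j) S
    rw [inter_comm S, Nat.dist]
    omega
  rw [sum_add_distrib] at h1
  have h4 := card_orderBlock_last π (by omega : 0 < 2 * a) hq
  have h5 := card_inter_add_card_sdiff (orderBlock π (2 * a) q q) S
  have h6 : q * (2 * a) = 2 * (q * a) := by ring
  rw [sum_range_succ]
  omega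

/-- If the bound fails, the union bound over all orders provides a balanced `S` across which the
rank of the sum is too small. The factor `2 * n` is the price of balancedness. -/
theorem two_pow_le_mul_of_razYehudayoff_eq_sum {F : Type*} [Field F] {n r s m h q a : ℕ}
    (hn : 0 < n) (hh : 1 ≤ h) (hs : 2 * s ≤ 2 ^ h) (hs0 : 0 < s) (ha : a = 128 * h ^ 2)
    (hq : q * (2 * a) ≤ 2 * n)
    (f : Fin m → MvPolynomial (Fin (2 * n)) (RYField F (2 * n)))
    (hf : ∀ j, ∃ P : ABP (Fin (2 * n)) (RYField F (2 * n)),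
      P.IsRPassMultilinear r ∧ P.size ≤ s ∧ P.poly = f j)
    (hg : razYehudayoff F (2 * n) = ∑ j, f j) :
    2 ^ q ≤ m * s ^ (r + 1) * (2 * n) := by
  by_contra! hlt
  choose P hP hsize hpoly using hf
  have ha0 : 0 < a := by
    rw [ha]
    positivity
  choose π hπ using fun j => (hP j).exists_orders (b := 2 * a) (by omega) q
  have hcard : Fintype.card (Σ j, (Fin r → Fin (P j).size)) ≤ m * s ^ r := by
    rw [Fintype.card_sigma]
    calc ∑ j, Fintype.card (Fin r → Fin (P j).size) ≤ ∑ _j : Fin m, s ^ r := by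
          refine sum_le_sum fun j _ => ?_
          rw [Fintype.card_fun, Fintype.card_fin, Fintype.card_fin]
          exact Nat.pow_le_pow_left (hsize j) r
      _ = m * s ^ r := by simp
  have hsr : s ^ r ≤ s ^ (r + 1) := Nat.pow_le_pow_right hs0 r.le_succ
  obtain ⟨S, hS, hdist⟩ := exists_balanced_le_sum_dist (α := Fin (2 * n)) (q := q)
    (ι := Σ j, (Fin r → Fin (P j).size)) hn (by simp) hh ha
    (fun t j => orderBlock (π t.1 t.2) (2 * a) q j)
    (fun t i j hij => orderBlock_disjoint _ _ _ (Fin.val_ne_of_ne hij))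
    (fun t j => card_orderBlock _ (by omega) hq j.2)
    (lt_of_le_of_lt (Nat.mul_le_mul_right _ (hcard.trans (Nat.mul_le_mul_left _ hsr))) hlt)
  have hrank : HasSplitRank S (∑ j, ∑ τ : Fin r → Fin (P j).size, (P j).size ^ (q + 1) *
      ∏ i ∈ range (q + 1), 2 ^ min #(orderBlock (π j τ) (2 * a) q i ∩ S)
        #(orderBlock (π j τ) (2 * a) q i \ S))
      fun A => MvPolynomial.eval (zeroOne (RYField F (2 * n)) A) (razYehudayoff F (2 * n)) := by
    simp only [hg, map_sum, ← hpoly]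
    exact HasSplitRank.sum fun j => hπ j S
  have h1 := two_pow_le_of_hasSplitRank_razYehudayoff F (by omega) hrank
  rw [hS] at h1
  -- Each read-once part has rank at most `s^(q+1) 2^(n - q h)`.
  have h2 : 2 ^ n * 2 ^ (q * h) ≤ m * s ^ r * (s ^ (q + 1) * 2 ^ n) := by
    refine (Nat.mul_le_mul_right _ h1).trans ?_
    rw [← Fintype.sum_sigma', sum_mul]
    refine (sum_le_card_nsmul _ _ (s ^ (q + 1) * 2 ^ n) fun t _ => ?_).trans ?_
    · rw [prod_pow_eq_pow_sum, mul_assoc, ← pow_add]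
      exact Nat.mul_le_mul (Nat.pow_le_pow_left (hsize _) _) (Nat.pow_le_pow_right two_pos
        (sum_min_orderBlock_add_le _ ha0 hq S (hdist t)))
    · rw [card_univ, smul_eq_mul]
      exact Nat.mul_le_mul_right _ hcard
  have h3 : 2 ^ q * s ^ q ≤ 2 ^ (q * h) := by
    rw [← mul_pow, mul_comm q h, pow_mul]
    exact Nat.pow_le_pow_left hs q
  have h4 : 2 ^ q * (s ^ q * 2 ^ n) ≤ m * s ^ (r + 1) * (s ^ q * 2 ^ n) := by
    calc 2 ^ q * (s ^ q * 2 ^ n) = 2 ^ n * (2 ^ q * s ^ q) := by ring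
      _ ≤ 2 ^ n * 2 ^ (q * h) := Nat.mul_le_mul_left _ h3
      _ ≤ _ := h2
      _ = _ := by ring
  have h5 := Nat.le_of_mul_le_mul_right h4 (by positivity)
  exact absurd (h5.trans (Nat.le_mul_of_pos_right _ (by omega))) (not_le.2 hlt)

theorem two_pow_le_of_razYehudayoff_eq_sum {F : Type*} [Field F] {n m : ℕ}
    (f : Fin m → MvPolynomial (Fin (2 * n)) (RYField F (2 * n)))
    (hf : ∀ j, ∃ P : ABP (Fin (2 * n)) (RYField F (2 * n)), P.size ≤ 1 ∧ P.poly = f j)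
    (hg : razYehudayoff F (2 * n) = ∑ j, f j) : 2 ^ n ≤ m := by
  obtain ⟨S, -, hS⟩ := exists_subset_card_eq (s := (univ : Finset (Fin (2 * n)))) (n := n)
    (by simp; omega)
  have hrank : HasSplitRank S (∑ _j : Fin m, 1)
      fun A => MvPolynomial.eval (zeroOne (RYField F (2 * n)) A) (razYehudayoff F (2 * n)) := by
    simp only [hg, map_sum]
    refine HasSplitRank.sum fun j => ?_
    obtain ⟨P, hP, hPj⟩ := hf j
    rw [← hPj]
    exact P.hasSplitRank_one_of_size_le_one hP S
  have h := two_pow_le_of_hasSplitRank_razYehudayoff F (by omega) hrank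
  rw [hS] at h
  simpa using h

/-- From `33 h ≤ y` follows `256 h² ≤ y² / 2`. There is slack: `y³ ≤ N` would suffice. -/
theorem rpow_one_fifth_le_div {N h : ℕ} {L y : ℝ} (hy : 1 ≤ y) (hN : y ^ 5 = N) (hh : 1 ≤ h)
    (hL : (h : ℝ) ≤ 3 * L) (hLy : 100 * L ≤ y) : y ≤ ((N / (256 * h ^ 2) : ℕ) : ℝ) := by
  have hh' : (1 : ℝ) ≤ h := by exact_mod_cast hh
  have h1 : (N : ℝ) / ((256 * h ^ 2 : ℕ) : ℝ) < ((N / (256 * h ^ 2) : ℕ) : ℝ) + 1 := by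
    rw [div_lt_iff₀ (by positivity)]
    have := Nat.lt_div_mul_add (a := N) (b := 256 * h ^ 2) (by positivity)
    rw [← Nat.succ_mul] at this
    exact_mod_cast this
  have h2 : y + 1 ≤ (N : ℝ) / ((256 * h ^ 2 : ℕ) : ℝ) := by
    rw [le_div_iff₀ (by positivity), ← hN]
    push_cast
    have h3 : 33 * (h : ℝ) ≤ y := by linarith
    have h4 : (33 * (h : ℝ)) ^ 2 ≤ y ^ 2 := by gcongr
    have h5 : 256 * (h : ℝ) ^ 2 ≤ y ^ 2 / 2 := by nlinarith
    have h6 : y ^ 2 ≤ y ^ 5 := pow_le_pow_right₀ hy (by norm_num)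
    have h7 : y ^ 3 ≤ y ^ 5 := pow_le_pow_right₀ hy (by norm_num)
    calc (y + 1) * (256 * (h : ℝ) ^ 2) ≤ (y + 1) * (y ^ 2 / 2) := by gcongr
      _ = (y ^ 3 + y ^ 2) / 2 := by ring
      _ ≤ y ^ 5 := by linarith
  linarith

end LowerBound

theorem mainTheorem2 :
    ∃ ε c : ℝ, 0 < ε ∧ 0 < c ∧
      ∀ (F : Type*) [Field F] (N : ℕ), 0 < N → Even N →
        ∀ (r s m : ℕ) (f : Fin m → MvPolynomial (Fin N) (RYField F N)),
          (∀ j, ∃ P : ABP (Fin N) (RYField F N),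
            P.IsRPassMultilinear r ∧ P.size ≤ s ∧ P.poly = f j) →
          razYehudayoff F N = ∑ j, f j →
          (2 : ℝ) ^ (ε * (N : ℝ) ^ (1 / 5 : ℝ)) / (s : ℝ) ^ (c * (r + Real.logb 2 N)) ≤ m := by
  -- The value `1/2` is used only for `s < 2`, where the bound is `2^n` with `n = N / 2`; `100` is
  -- the threshold in `y ≤ 100 L` below.
  refine ⟨1 / 2, 100, by norm_num, by norm_num, fun F _ N hN hev r s m f hf hg => ?_⟩
  obtain ⟨n, hNn⟩ := even_iff_exists_two_mul.1 hev
  have hconst : (∀ j, ∃ P : ABP (Fin N) (RYField F N), P.size ≤ 1 ∧ P.poly = f j) → 2 ^ n ≤ m := by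
    subst hNn
    exact fun h => two_pow_le_of_razYehudayoff_eq_sum f h hg
  have hbound : ∀ h q, 1 ≤ h → 2 * s ≤ 2 ^ h → 0 < s → q * (2 * (128 * h ^ 2)) ≤ N →
      2 ^ q ≤ m * s ^ (r + 1) * N := by
    subst hNn
    exact fun h q hh hs hs0 hq =>
      two_pow_le_mul_of_razYehudayoff_eq_sum (by omega) hh hs hs0 rfl hq f hf hg
  have hN2 : (2 : ℝ) ≤ N := by
    have : 2 ≤ N := by omega
    exact_mod_cast this
  set y : ℝ := (N : ℝ) ^ (1 / 5 : ℝ) with hy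
  have hy1 : 1 ≤ y := Real.one_le_rpow (by linarith) (by norm_num)
  have hy5 : y ^ 5 = N := by
    rw [hy, ← Real.rpow_natCast, ← Real.rpow_mul (by linarith)]
    norm_num
  have hℓ : 1 ≤ Real.logb 2 N := by
    rw [Real.le_logb_iff_rpow_le (by norm_num) (by linarith), Real.rpow_one]
    exact hN2
  set ℓ := Real.logb 2 N with hℓdef
  have hexp : 0 < 100 * ((r : ℝ) + ℓ) := by positivity
  -- For `s ≤ 1` no power of `s` can absorb the factor `N`, so this case goes through constant
  -- summands; for `s = 0` the quotient is `0` by convention.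
  rcases Nat.lt_or_ge s 2 with hs | hs
  · have h1 : 2 ^ n ≤ m := hconst (fun j => by
      obtain ⟨P, -, hPs, hPj⟩ := hf j
      exact ⟨P, by omega, hPj⟩)
    have h2 : (2 : ℝ) ^ (1 / 2 * y) ≤ m := by
      calc (2 : ℝ) ^ (1 / 2 * y) ≤ 2 ^ (n : ℝ) := by
            refine Real.rpow_le_rpow_of_exponent_le (by norm_num) ?_
            have h3 : y ≤ y ^ 5 := le_self_pow₀ hy1 (by norm_num)
            rw [hy5, hNn] at h3
            push_cast at h3
            linarith
        _ ≤ m := by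
            rw [Real.rpow_natCast]
            exact_mod_cast h1
    interval_cases s
    · rw [Nat.cast_zero, Real.zero_rpow hexp.ne', div_zero]
      exact m.cast_nonneg
    · rwa [Nat.cast_one, Real.one_rpow, div_one]
  have hsR : (2 : ℝ) ≤ s := by exact_mod_cast hs
  have hs0 : (0 : ℝ) < s := by linarith
  have hm : 1 ≤ m := by
    by_contra hm
    have hm0 : m = 0 := by omega
    subst hm0
    have := hconst fun j => j.elim0
    exact absurd this (by simp)
  have hmR : (1 : ℝ) ≤ m := by exact_mod_cast hm
  set L := Real.logb 2 s with hLdef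
  have hL : 1 ≤ L := by
    rw [hLdef, Real.le_logb_iff_rpow_le (by norm_num) hs0, Real.rpow_one]
    exact hsR
  have h2L : (2 : ℝ) ^ L = s := Real.rpow_logb (by norm_num) (by norm_num) hs0
  have hpos : (0 : ℝ) < (s : ℝ) ^ (100 * ((r : ℝ) + ℓ)) := Real.rpow_pos_of_pos hs0 _
  rw [div_le_iff₀ hpos]
  have hhalf : (2 : ℝ) ^ (1 / 2 * y) ≤ 2 ^ y :=
    Real.rpow_le_rpow_of_exponent_le (by norm_num) (by linarith)
  refine hhalf.trans ?_
  -- If `s` is this large, the claimed bound is at most `1`.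
  rcases le_or_gt y (100 * L) with hsmall | hlarge
  · calc (2 : ℝ) ^ y ≤ 2 ^ (L * (100 * (r + ℓ))) := by
          refine Real.rpow_le_rpow_of_exponent_le (by norm_num) ?_
          have : (0 : ℝ) ≤ r := r.cast_nonneg
          nlinarith
      _ = (s : ℝ) ^ (100 * (r + ℓ)) := by rw [Real.rpow_mul (by norm_num), h2L]
      _ ≤ m * (s : ℝ) ^ (100 * (r + ℓ)) := le_mul_of_one_le_left hpos.le hmR
  set h := Nat.clog 2 s + 1 with hh
  have hhL : (h : ℝ) ≤ 3 * L := by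
    have h1 : ((Nat.clog 2 s : ℕ) : ℝ) < L + 1 := by
      rw [← Real.natCeil_logb_natCast]
      exact Nat.ceil_lt_add_one (by simpa using by linarith)
    rw [hh]
    push_cast
    linarith
  have hmain := hbound h (N / (256 * h ^ 2)) (by omega)
    (by
      rw [hh, pow_succ, mul_comm]
      exact Nat.mul_le_mul_right _ (Nat.le_pow_clog (by norm_num) s))
    (by omega)
    (by
      rw [← mul_assoc 2 128]
      exact Nat.div_mul_le_self _ _)
  have hq := rpow_one_fifth_le_div hy1 hy5 (by omega : 1 ≤ h) hhL hlarge.le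
  have hmain' : (2 : ℝ) ^ (N / (256 * h ^ 2)) ≤ m * (s : ℝ) ^ (r + 1) * N := by
    exact_mod_cast hmain
  -- This absorbs the factor `N` and is the source of `log N` in the exponent.
  have hNs : (N : ℝ) ≤ (s : ℝ) ^ ℓ := by
    calc (N : ℝ) = 2 ^ ℓ := (Real.rpow_logb (by norm_num) (by norm_num) (by linarith)).symm
      _ ≤ (s : ℝ) ^ ℓ := Real.rpow_le_rpow (by norm_num) hsR (by linarith)
  calc (2 : ℝ) ^ y ≤ 2 ^ ((N / (256 * h ^ 2) : ℕ) : ℝ) :=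
        Real.rpow_le_rpow_of_exponent_le (by norm_num) hq
    _ = 2 ^ (N / (256 * h ^ 2)) := Real.rpow_natCast _ _
    _ ≤ m * (s : ℝ) ^ (r + 1) * N := hmain'
    _ ≤ m * (s : ℝ) ^ (r + 1) * (s : ℝ) ^ ℓ := by gcongr
    _ = m * (s : ℝ) ^ ((r : ℝ) + 1 + ℓ) := by
        rw [mul_assoc, Real.rpow_add hs0]
        congr 2
        exact_mod_cast (Real.rpow_natCast (s : ℝ) (r + 1)).symm
    _ ≤ m * (s : ℝ) ^ (100 * ((r : ℝ) + ℓ)) := by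
        gcongr
        · linarith
        · have : (0 : ℝ) ≤ r := r.cast_nonneg
          linarith
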